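/- Let $(a_n)_{n\in\mathbb Z}$, $(p_n)_{n\in\mathbb Z}$, $(q_n)_{n\in\mathbb Z}$ be complex sequences with $a_n\neq 0$ for all $n$ and $$\sup_{n\in\mathbb Z}\ e^{\varepsilon|n|^{\delta}}\bigl(|1-a_n|+|p_n|+|q_n|\bigr)<\infty\qquad\text{for some }\varepsilon>0,\ \tfrac12\le\delta\le 1,$$ and consider the quadratic pencil equation $$\Delta(a_{n-1}\Delta y_{n-1})+(q_n+2\lambda p_n+\lambda^2)\,y_n=0,\quad n\in\mathbb Z,\qquad \Delta y_n=y_{n+1}-y_n .\tag{1}$$ For $\operatorname{Im}z>0$ let $f^{\pm}(z)=(f^\pm_n(z))_{n\in\mathbb Z}$ be the Jost solutions of (1) with $\lambda=2\cos(z/2)$, i.e. the solutions with $f_n^{\pm}(z)=(-1)^n e^{\pm inz}(1+o(1))$ as $n\to\pm\infty$. For $\lambda\in\Theta=\mathbb C\setminus[-2,2]$ put $F_n^{\pm}(\lambda)=f_n^{\pm}(2\arccos(\lambda/2))$, where $z=2\arccos(\lambda/2)$ is the branch with $2\cos(z/2)=\lambda$, $\operatorname{Im}z>0$, $-\pi<\operatorname{Re}z\le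 3\pi$, and let $$H(\lambda)=W[F^-(\lambda),F^+(\lambda)],\qquad W[u,v]=a_n(u_nv_{n+1}-u_{n+1}v_n),$$ which does not depend on $n$. A boundary point of $\Theta$ over the cut $[-2,2]$ (a point of the cut together with a side of the cut) is described by $z_0\in P_0=(-\pi,3\pi)\setminus\{0,\pi,2\pi\}$: it lies over $2\cos(z_0/2)$, and the boundary value there of a function $G$ on $\Theta$ is $\lim G(2\cos(z/2))$ as $z\to z_0$, $\operatorname{Im}z>0$. The eigenvalues are the zeros of $H$ in $\Theta$. The spectral singularities are the boundary zeros of $H$, i.e. the zeros of the boundary values of $H$ at the points described by $z_0\in P_0$. The multiplicity $m_j$ of an eigenvalue or spectral singularity $\lambda_j$ is its multiplicity as a zero of $H$, i.e. the order of the first $\lambda$-derivative of $H$ that does not vanish there (for a spectral singularity, derivatives are taken in the sense of boundary values). Define $$U^{(r)}(\lambda_j)=\bigl(U^{(r)}_n(\lambda_j)\bigr)_{n\in\mathbb Z},\qquad U_n^{(r)}(\lambda_j)=\frac1{r!}\frac{d^r}{d\lambda^r}F_n^+(\lambda)\Big|_{\lambda=\lambda_j},\qquad r=0,1,\dots,m_j-1,$$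 again understood as a boundary value if $\lambda_j$ is a spectral singularity. For $s\in\mathbb Z$ let $H_s(\mathbb Z)=\{y:\sum_{n\in\mathbb Z}(1+|n|)^{2s}|y_n|^2<\infty\}$, and let $p_0$ be the maximum of the multiplicities of all eigenvalues and spectral singularities. Then: (i) if $\lambda_j$ is an eigenvalue, then every $F_n^+$ is analytic at $\lambda_j$ and $U^{(r)}(\lambda_j)\in\ell^2(\mathbb Z)$ for $r=0,\dots,m_j-1$; (ii) if $\lambda_j$ is a spectral singularity, then the boundary values that define $U^{(r)}(\lambda_j)$ exist and $U^{(r)}(\lambda_j)\notin\ell^2(\mathbb Z)$ for $r=0,\dots,m_j-1$; (iii) if $\lambda_j$ is a spectral singularity, then $U^{(r)}(\lambda_j)\in H_{-m_j}(\mathbb Z)$ for $r=0,\dots,m_j-1$; consequently $U^{(r)}(\lambda_j)\in H_{-p_0}(\mathbb Z)\subset H_{-(p_0+1)}(\mathbb Z)$. -/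

import Mathlib

open Filter Topology

noncomputable section

/-- The quadratic pencil of difference expressions
`Δ(a_{n-1} Δ y_{n-1}) + (q_n + 2 λ p_n + λ²) y_n`. -/
def pencil (a p q : ℤ → ℂ) (lam : ℂ) (y : ℤ → ℂ) (n : ℤ) : ℂ :=
  fwdDiff (1 : ℤ) (fun k => a (k - 1) * fwdDiff (1 : ℤ) y (k - 1)) n
    + (q n + 2 * lam * p n + lam ^ 2) * y n

/-- `f` is the Jost solution at `+∞` for `λ = 2 cos (z / 2)`: it solves the pencil equation and
`f_n = (-1)^n e^{inz} (1 + o(1))` as `n → ∞`. (The unperturbed equation reads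
`y_{n+1} + y_{n-1} + 2 cos z y_n = 0`, with solutions `(-1)^n e^{± inz}`.) -/
def IsJostPlus (a p q : ℤ → ℂ) (z : ℂ) (f : ℤ → ℂ) : Prop :=
  (∀ n, pencil a p q (2 * Complex.cos (z / 2)) f n = 0) ∧
  Tendsto (fun n : ℤ => f n / ((-1) ^ n * Complex.exp (Complex.I * n * z))) atTop (𝓝 1)

/-- `f` is the Jost solution at `-∞` for `λ = 2 cos (z / 2)`: it solves the pencil equation and
`f_n = (-1)^n e^{-inz} (1 + o(1))` as `n → -∞`. -/
def IsJostMinus (a p q : ℤ → ℂ) (z : ℂ) (f : ℤ → ℂ) : Prop :=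
  (∀ n, pencil a p q (2 * Complex.cos (z / 2)) f n = 0) ∧
  Tendsto (fun n : ℤ => f n / ((-1) ^ n * Complex.exp (-(Complex.I * n * z)))) atBot (𝓝 1)

/-- The Jost solution `f⁺(z)`, `Im z ≥ 0`. -/
def jostPlus (a p q : ℤ → ℂ) (z : ℂ) : ℤ → ℂ :=
  Classical.epsilon (IsJostPlus a p q z)

/-- The Jost solution `f⁻(z)`, `Im z ≥ 0`. -/
def jostMinus (a p q : ℤ → ℂ) (z : ℂ) : ℤ → ℂ :=
  Classical.epsilon (IsJostMinus a p q z)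

/-- `Θ = ℂ \ [-2, 2]`. -/
def Theta : Set ℂ := ((fun x : ℝ => (x : ℂ)) '' Set.Icc (-2) 2)ᶜ

/-- The branch of `2 arccos (λ / 2)` on `Θ` with values in the upper half-plane: the unique
`z` with `2 cos (z / 2) = λ`, `Im z > 0` and `-π < Re z ≤ 3π`. -/
def twoArccosHalf (lam : ℂ) : ℂ :=
  Classical.epsilon fun z : ℂ =>
    0 < z.im ∧ -Real.pi < z.re ∧ z.re ≤ 3 * Real.pi ∧ 2 * Complex.cos (z / 2) = lam

/-- `F⁺_n(λ) = f⁺_n(2 arccos (λ / 2))`. -/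
def FPlus (a p q : ℤ → ℂ) (n : ℤ) (lam : ℂ) : ℂ := jostPlus a p q (twoArccosHalf lam) n

/-- `F⁻_n(λ) = f⁻_n(2 arccos (λ / 2))`. -/
def FMinus (a p q : ℤ → ℂ) (n : ℤ) (lam : ℂ) : ℂ := jostMinus a p q (twoArccosHalf lam) n

/-- The Wronskian `W[u, v] = a_n (u_n v_{n+1} - u_{n+1} v_n)`; for two solutions of the same
pencil equation it does not depend on `n`, and it is evaluated at `n = 0`. -/
def wronskian (a : ℤ → ℂ) (u v : ℤ → ℂ) : ℂ := a 0 * (u 0 * v 1 - u 1 * v 0)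

/-- `H(λ) = W[F⁻(λ), F⁺(λ)]`. -/
def HFun (a p q : ℤ → ℂ) (lam : ℂ) : ℂ :=
  wronskian a (fun n => FMinus a p q n lam) (fun n => FPlus a p q n lam)

/-- `λ ∈ Θ` is a zero of `H` (that is, an eigenvalue of the pencil) of multiplicity `m ≥ 1`. -/
def IsEigenvalueOfMult (a p q : ℤ → ℂ) (lam : ℂ) (m : ℕ) : Prop :=
  lam ∈ Theta ∧ 1 ≤ m ∧ analyticOrderAt (HFun a p q) lam = m

/-- `P₀ = (-π, 3π) \ {0, π, 2π}`. Under `z ↦ 2 cos (z / 2)` it parametrizes the two sides of the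
cut `[-2, 2]` of `Θ`, without the points over `-2, 0, 2`. -/
def P0 : Set ℝ := Set.Ioo (-Real.pi) (3 * Real.pi) \ {0, Real.pi, 2 * Real.pi}

/-- `G`, a function on `Θ`, has the boundary value `c` at the boundary point of `Θ` (a point of
the cut together with a side of the cut) given by `z₀ ∈ P₀`:
`G(2 cos (z / 2)) → c` as `z → z₀`, `Im z > 0`. -/
def HasBoundaryValue (G : ℂ → ℂ) (z₀ : ℝ) (c : ℂ) : Prop :=
  Tendsto (fun z : ℂ => G (2 * Complex.cos (z / 2))) (𝓝[{z : ℂ | 0 < z.im}] (z₀ : ℂ)) (𝓝 c)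

/-- The boundary value itself. -/
def boundaryValue (G : ℂ → ℂ) (z₀ : ℝ) : ℂ :=
  limUnder (𝓝[{z : ℂ | 0 < z.im}] (z₀ : ℂ)) (fun z : ℂ => G (2 * Complex.cos (z / 2)))

/-- `λ = 2 cos (z₀ / 2)`, `z₀ ∈ P₀`, is a spectral singularity of multiplicity `m ≥ 1`: on the side
of the cut given by `z₀`, the `λ`-derivatives of `H` of order `< m` vanish, the `m`-th does not. -/
def IsSpectralSingularityOfMult (a p q : ℤ → ℂ) (z₀ : ℝ) (m : ℕ) : Prop :=
  z₀ ∈ P0 ∧ 1 ≤ m ∧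
  (∀ v < m, HasBoundaryValue (iteratedDeriv v (HFun a p q)) z₀ 0) ∧
  ∃ c : ℂ, c ≠ 0 ∧ HasBoundaryValue (iteratedDeriv m (HFun a p q)) z₀ c

/-- The set of the multiplicities of all eigenvalues and spectral singularities. -/
def multiplicities (a p q : ℤ → ℂ) : Set ℕ :=
  {m | (∃ lam, IsEigenvalueOfMult a p q lam m) ∨ ∃ z₀, IsSpectralSingularityOfMult a p q z₀ m}

/-- `λ ↦ (1 / r!) (d/dλ)^r F⁺_n(λ)` on `Θ`; its values at an eigenvalue `λ_j` are the components of
the principal vector `U^{(r)}(λ_j)`. -/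
def principalVector (a p q : ℤ → ℂ) (r : ℕ) (lam : ℂ) (n : ℤ) : ℂ :=
  iteratedDeriv r (FPlus a p q n) lam / (Nat.factorial r : ℂ)

/-- The principal vector `U^{(r)}(λ_j)` at a spectral singularity `λ_j = 2 cos (z₀ / 2)`: the
boundary values of `(1 / r!) (d/dλ)^r F⁺_n(λ)`. -/
def principalVectorSing (a p q : ℤ → ℂ) (r : ℕ) (z₀ : ℝ) (n : ℤ) : ℂ :=
  boundaryValue (fun lam => principalVector a p q r lam n) z₀

/-- The weighted space `H_p(ℤ)`, `p ∈ ℤ`, of the sequences with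
`∑ (1 + |n|)^{2p} |y_n|² < ∞`. -/
def weightedSpace (p : ℤ) : Set (ℤ → ℂ) :=
  {y | Summable fun n : ℤ => (1 + |(n : ℝ)|) ^ (2 * p) * ‖y n‖ ^ 2}

end

noncomputable section

/-! Put w = e^{iz} and λ = 2 cos(z/2). Then λ² = 2 + w + w⁻¹, and the unperturbed equation has the
modes (-w)^n and (-w)^{-n}. The decay hypothesis enters only through its consequence `ShortRange`:
every moment of |a_n⁻¹ - 1| + |p_n| + |q_n| is finite.

The core is the smoothness of f⁺ up to real z, and no analytic continuation of f⁺ below the real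
axis is needed for it. The quotient f⁺_n / (-w)^n is 1 plus a telescoping series over cut-offs,
whose k-th term compares the solutions that are free from n + k + 1 on and from n + k on. Each term
is entire in z. The normalized free backward step has multipliers 1 and w², so the k-th term is
O(`pert` (n + k)) as long as |w|^{2k} stays bounded, in particular for Im z ≥ -1/(k + 1)
(`norm_jostIncr_le`). Cauchy's estimate on discs of radius proportional to 1/(k + 1) bounds its r-th
λ-derivative by a constant times (k + 1)^r `pert` (n + k) (`norm_iteratedDeriv_le_of_im_bound`).
This is summable, so all derivatives extend continuously to the boundary.

At a spectral singularity the free mode has modulus 1, and its r-th λ-derivative is the mode times a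
polynomial in n with leading coefficient (i dz/dλ)^r ≠ 0. By Leibniz's rule U^{(r)}_n is O((1 +
|n|)^r) on ℤ and is exactly of order n^r at +∞ (`principalVectorSing_spec`). The second fact
excludes ℓ², the first gives H_{-M} for every M > r.

At an eigenvalue, F⁺ and its derivatives decay exponentially at +∞, and F⁻ and its derivatives at
-∞. Since H = W[F⁻, F⁺] vanishes to order m, F⁺ = c F⁻ + O((λ - λ_j)^m) at each site, with c
analytic near λ_j and independent of the site. Derivatives of F⁺ of order below m are therefore
combinations of derivatives of F⁻ and decay at -∞ as well (`exists_iteratedDeriv_FPlus_eq`). -/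

/-- The size of the perturbation at the site `n`. -/
def pert (a p q : ℤ → ℂ) (n : ℤ) : ℝ := ‖(a n)⁻¹ - 1‖ + ‖p n‖ + ‖q n‖

/-! ### Transfer maps in the coordinates of the free modes -/

/-- The backward transfer step for the normalized state
`(y_n, a_{n-1} (y_n - y_{n-1})) / (-w)^n`. -/
def stepBack (a p q : ℤ → ℂ) (w lam : ℂ) (n : ℤ) (x : ℂ × ℂ) : ℂ × ℂ :=
  (-w * (x.1 - (a n)⁻¹ * x.2),
    -w * x.2 + (q n + 2 * lam * p n + lam ^ 2) * (-w * (x.1 - (a n)⁻¹ * x.2)))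

/-- The transfer map from the site `n + k` to the site `n`. -/
def backIter (a p q : ℤ → ℂ) (w lam : ℂ) : ℕ → ℤ → ℂ × ℂ → ℂ × ℂ
  | 0, _, x => x
  | k + 1, n, x => stepBack a p q w lam n (backIter a p q w lam k (n + 1) x)

/-- The sum of the moduli of the coordinates of a state with respect to the two free modes. -/
def modeNorm (w : ℂ) (x : ℂ × ℂ) : ℝ :=
  ‖(x.2 - (1 + w) * x.1) * (w - w⁻¹)⁻¹‖ + ‖(x.2 - (1 + w⁻¹) * x.1) * (w - w⁻¹)⁻¹‖

/-- `w = e^{iz}` and `lam = 2 cos (z / 2)` are related as they should, and stay quantitatively away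
from the points where the two free modes coincide. -/
structure Nondegenerate (R : ℝ) (w lam : ℂ) : Prop where
  w_ne : w ≠ 0
  sub_ne : w - w⁻¹ ≠ 0
  sq_eq : lam ^ 2 = 2 + w + w⁻¹
  w_le : ‖w‖ ≤ R
  inv_le : ‖w⁻¹‖ ≤ R
  lam_le : ‖lam‖ ≤ R
  sub_inv_le : ‖(w - w⁻¹)⁻¹‖ ≤ R

lemma Nondegenerate.one_le {R : ℝ} {w lam : ℂ} (h : Nondegenerate R w lam) : 1 ≤ R := by
  by_contra! hR
  have h1 : ‖w‖ * ‖w⁻¹‖ = 1 := by rw [← norm_mul, mul_inv_cancel₀ h.w_ne, norm_one]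
  nlinarith [h.w_le, h.inv_le, norm_nonneg w, norm_nonneg w⁻¹]

lemma Nondegenerate.mono {R R' : ℝ} {w lam : ℂ} (h : Nondegenerate R w lam) (hR : R ≤ R') :
    Nondegenerate R' w lam :=
  ⟨h.w_ne, h.sub_ne, h.sq_eq, h.w_le.trans hR, h.inv_le.trans hR, h.lam_le.trans hR,
    h.sub_inv_le.trans hR⟩

lemma pert_nonneg (a p q : ℤ → ℂ) (n : ℤ) : 0 ≤ pert a p q n := by
  unfold pert; positivity

lemma modeNorm_nonneg (w : ℂ) (x : ℂ × ℂ) : 0 ≤ modeNorm w x := by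
  unfold modeNorm; positivity

lemma modeNorm_add_le (w : ℂ) (x y : ℂ × ℂ) :
    modeNorm w (x + y) ≤ modeNorm w x + modeNorm w y := by
  unfold modeNorm
  have h1 := norm_add_le ((x.2 - (1 + w) * x.1) * (w - w⁻¹)⁻¹)
    ((y.2 - (1 + w) * y.1) * (w - w⁻¹)⁻¹)
  have h2 := norm_add_le ((x.2 - (1 + w⁻¹) * x.1) * (w - w⁻¹)⁻¹)
    ((y.2 - (1 + w⁻¹) * y.1) * (w - w⁻¹)⁻¹)
  have e1 : ((x + y).2 - (1 + w) * (x + y).1) * (w - w⁻¹)⁻¹ =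
      (x.2 - (1 + w) * x.1) * (w - w⁻¹)⁻¹ + (y.2 - (1 + w) * y.1) * (w - w⁻¹)⁻¹ := by
    simp only [Prod.fst_add, Prod.snd_add]; ring
  have e2 : ((x + y).2 - (1 + w⁻¹) * (x + y).1) * (w - w⁻¹)⁻¹ =
      (x.2 - (1 + w⁻¹) * x.1) * (w - w⁻¹)⁻¹ + (y.2 - (1 + w⁻¹) * y.1) * (w - w⁻¹)⁻¹ := by
    simp only [Prod.fst_add, Prod.snd_add]; ring
  rw [e1, e2]
  linarith

section
variable {R : ℝ} {w lam : ℂ}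

lemma norm_fst_le_modeNorm (h : Nondegenerate R w lam) (x : ℂ × ℂ) : ‖x.1‖ ≤ modeNorm w x := by
  have h0 := h.sub_ne
  have e : x.1 = (x.2 - (1 + w⁻¹) * x.1) * (w - w⁻¹)⁻¹ - (x.2 - (1 + w) * x.1) * (w - w⁻¹)⁻¹ := by
    have : (x.2 - (1 + w⁻¹) * x.1) * (w - w⁻¹)⁻¹ - (x.2 - (1 + w) * x.1) * (w - w⁻¹)⁻¹
      = x.1 * ((w - w⁻¹) * (w - w⁻¹)⁻¹) := by ring
    rw [this, mul_inv_cancel₀ h0, mul_one]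
  unfold modeNorm
  have := norm_sub_le ((x.2 - (1 + w⁻¹) * x.1) * (w - w⁻¹)⁻¹) ((x.2 - (1 + w) * x.1) * (w - w⁻¹)⁻¹)
  rw [← e] at this
  linarith

lemma norm_snd_le_modeNorm (h : Nondegenerate R w lam) (x : ℂ × ℂ) :
    ‖x.2‖ ≤ (1 + R) * modeNorm w x := by
  have h0 := h.sub_ne
  have e : x.2 = (1 + w) * ((x.2 - (1 + w⁻¹) * x.1) * (w - w⁻¹)⁻¹) -
      (1 + w⁻¹) * ((x.2 - (1 + w) * x.1) * (w - w⁻¹)⁻¹) := by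
    have : (1 + w) * ((x.2 - (1 + w⁻¹) * x.1) * (w - w⁻¹)⁻¹) -
      (1 + w⁻¹) * ((x.2 - (1 + w) * x.1) * (w - w⁻¹)⁻¹)
      = x.2 * ((w - w⁻¹) * (w - w⁻¹)⁻¹) := by ring
    rw [this, mul_inv_cancel₀ h0, mul_one]
  have b1 : ‖1 + w‖ ≤ 1 + R := (norm_add_le _ _).trans (by simpa using h.w_le)
  have b2 : ‖1 + w⁻¹‖ ≤ 1 + R := (norm_add_le _ _).trans (by simpa using h.inv_le)
  unfold modeNorm
  set A := (x.2 - (1 + w) * x.1) * (w - w⁻¹)⁻¹ with hA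
  set B := (x.2 - (1 + w⁻¹) * x.1) * (w - w⁻¹)⁻¹ with hB
  calc ‖x.2‖ = ‖(1 + w) * B - (1 + w⁻¹) * A‖ := by rw [← e]
    _ ≤ ‖1 + w‖ * ‖B‖ + ‖1 + w⁻¹‖ * ‖A‖ := by
      rw [← norm_mul, ← norm_mul]
      exact norm_sub_le _ _
    _ ≤ (1 + R) * ‖B‖ + (1 + R) * ‖A‖ := by gcongr
    _ = _ := by ring

lemma modeNorm_le (h : Nondegenerate R w lam) (x : ℂ × ℂ) :
    modeNorm w x ≤ 2 * R * ((1 + R) * ‖x.1‖ + ‖x.2‖) := by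
  have hR := h.one_le
  have b1 : ‖1 + w‖ ≤ 1 + R := (norm_add_le _ _).trans (by simpa using h.w_le)
  have b2 : ‖1 + w⁻¹‖ ≤ 1 + R := (norm_add_le _ _).trans (by simpa using h.inv_le)
  have key : ∀ c : ℂ, ‖c‖ ≤ 1 + R →
      ‖(x.2 - c * x.1) * (w - w⁻¹)⁻¹‖ ≤ R * ((1 + R) * ‖x.1‖ + ‖x.2‖) := by
    intro c hc
    rw [norm_mul, mul_comm]
    have : ‖x.2 - c * x.1‖ ≤ (1 + R) * ‖x.1‖ + ‖x.2‖ := by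
      refine (norm_sub_le _ _).trans ?_
      rw [norm_mul, add_comm]
      gcongr
    exact mul_le_mul h.sub_inv_le this (norm_nonneg _) (by linarith)
  unfold modeNorm
  linarith [key _ b1, key _ b2]

variable {a p q : ℤ → ℂ}

lemma stepBack_sub (n : ℤ) (x y : ℂ × ℂ) :
    stepBack a p q w lam n (x - y) = stepBack a p q w lam n x - stepBack a p q w lam n y := by
  ext <;> simp only [stepBack, Prod.fst_sub, Prod.snd_sub] <;> ring

lemma backIter_sub (k : ℕ) (n : ℤ) (x y : ℂ × ℂ) :
    backIter a p q w lam k n (x - y) =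
      backIter a p q w lam k n x - backIter a p q w lam k n y := by
  induction k generalizing n with
  | zero => rfl
  | succ k ih => simp only [backIter, ih, stepBack_sub]

/-- The recursion peels off the leftmost site. Peeling off the rightmost one shows that the cut-offs
at k and k + 1 share their last k backward steps, so that their difference is a transported one-step
error. -/
lemma backIter_succ_right (k : ℕ) (n : ℤ) (x : ℂ × ℂ) :
    backIter a p q w lam (k + 1) n x =
      backIter a p q w lam k n (stepBack a p q w lam (n + k) x) := by
  induction k generalizing n with
  | zero => simp [backIter]
  | succ k ih =>
    rw [backIter, ih, backIter]
    congr 3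
    push_cast
    ring

/-- The step constant: a bound for the relative effect of the perturbation. -/
def stepConst (R : ℝ) : ℝ := 2 * R * ((1 + R) * (R * (1 + R)) + (R ^ 2 * (R * (1 + R)) +
  (2 * R + 1) * (R * (1 + R * (1 + R)))))

lemma stepConst_nonneg (hR : 1 ≤ R) : 0 ≤ stepConst R := by
  unfold stepConst; positivity

/-- The effect of the perturbation on one step. -/
lemma modeNorm_stepBack_sub_free (h : Nondegenerate R w lam) (n : ℤ) (han : ‖(a n)⁻¹‖ ≤ R)
    (x : ℂ × ℂ) :
    modeNorm w (stepBack a p q w lam n x - stepBack (fun _ => 1) 0 0 w lam n x) ≤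
      stepConst R * pert a p q n * modeNorm w x := by
  have hR := h.one_le
  set s := modeNorm w x with hs
  set e := pert a p q n with he
  have hs0 : 0 ≤ s := modeNorm_nonneg _ _
  have he0 : 0 ≤ e := pert_nonneg _ _ _ _
  have e1 : ‖(a n)⁻¹ - 1‖ ≤ e := by
    rw [he, pert]; linarith [norm_nonneg (p n), norm_nonneg (q n)]
  have e2 : ‖p n‖ + ‖q n‖ ≤ e := by
    rw [he, pert]; linarith [norm_nonneg ((a n)⁻¹ - 1)]
  have x1 : ‖x.1‖ ≤ s := norm_fst_le_modeNorm h x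
  have x2 : ‖x.2‖ ≤ (1 + R) * s := norm_snd_le_modeNorm h x
  set dg := w * (x.2 * ((a n)⁻¹ - 1)) with hdg
  set g := -w * (x.1 - (a n)⁻¹ * x.2) with hg
  have d1 : ‖dg‖ ≤ (R * (1 + R)) * (e * s) := by
    rw [hdg, norm_mul, norm_mul]
    calc ‖w‖ * (‖x.2‖ * ‖(a n)⁻¹ - 1‖) ≤ R * (((1 + R) * s) * e) := by
          gcongr
          exact h.w_le
      _ = _ := by ring
  have g1 : ‖g‖ ≤ (R * (1 + R * (1 + R))) * s := by
    rw [hg, norm_mul, norm_neg]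
    calc ‖w‖ * ‖x.1 - (a n)⁻¹ * x.2‖ ≤ R * (s + R * ((1 + R) * s)) := by
          gcongr
          · exact h.w_le
          · refine (norm_sub_le _ _).trans ?_
            rw [norm_mul]
            gcongr
      _ = _ := by ring
  have k1 : ‖q n + 2 * lam * p n‖ ≤ (2 * R + 1) * e := by
    refine (norm_add_le _ _).trans ?_
    rw [norm_mul, norm_mul, Complex.norm_ofNat]
    have := h.lam_le
    calc ‖q n‖ + 2 * ‖lam‖ * ‖p n‖ ≤ ‖q n‖ + 2 * R * ‖p n‖ := by gcongr
      _ ≤ (2 * R + 1) * (‖p n‖ + ‖q n‖) := by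
        nlinarith [norm_nonneg (p n), norm_nonneg (q n)]
      _ ≤ _ := by gcongr
  have d2 : ‖lam ^ 2 * dg + (q n + 2 * lam * p n) * g‖ ≤
      (R ^ 2 * (R * (1 + R)) + (2 * R + 1) * (R * (1 + R * (1 + R)))) * (e * s) := by
    refine (norm_add_le _ _).trans ?_
    rw [norm_mul (lam ^ 2) dg, norm_mul _ g, norm_pow]
    have := h.lam_le
    calc ‖lam‖ ^ 2 * ‖dg‖ + ‖q n + 2 * lam * p n‖ * ‖g‖
        ≤ R ^ 2 * ((R * (1 + R)) * (e * s)) +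
          ((2 * R + 1) * e) * ((R * (1 + R * (1 + R))) * s) := by gcongr
      _ = _ := by ring
  have eq : stepBack a p q w lam n x - stepBack (fun _ => 1) 0 0 w lam n x =
      (dg, lam ^ 2 * dg + (q n + 2 * lam * p n) * g) := by
    ext
    · simp only [stepBack, Prod.fst_sub, hdg]; ring
    · simp only [stepBack, Prod.snd_sub, hdg, hg, Pi.zero_apply]; ring
  rw [eq]
  refine (modeNorm_le h _).trans ?_
  unfold stepConst
  calc _ ≤ 2 * R * ((1 + R) * ((R * (1 + R)) * (e * s)) +
        (R ^ 2 * (R * (1 + R)) + (2 * R + 1) * (R * (1 + R * (1 + R)))) * (e * s)) := by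
        dsimp only
        gcongr
    _ = _ := by ring

/-- In the basis (1, 1 + w⁻¹), (1, 1 + w) of states of the two free modes, the free step is diagonal
with multipliers 1 and w². -/
lemma modeNorm_free_step (h : Nondegenerate R w lam) (n : ℤ) (x : ℂ × ℂ) :
    modeNorm w (stepBack (fun _ => 1) 0 0 w lam n x) ≤ max 1 (‖w‖ ^ 2) * modeNorm w x := by
  have hw := h.w_ne
  set y := stepBack (fun _ => 1) 0 0 w lam n x with hy
  have y1 : y.1 = -w * (x.1 - x.2) := by simp [hy, stepBack]
  have y2 : y.2 = -w * x.2 + lam ^ 2 * (-w * (x.1 - x.2)) := by simp [hy, stepBack]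
  have h1 : y.2 - (1 + w) * y.1 = x.2 - (1 + w) * x.1 := by
    rw [y1, y2, h.sq_eq]; field_simp; ring
  have h2 : y.2 - (1 + w⁻¹) * y.1 = w ^ 2 * (x.2 - (1 + w⁻¹) * x.1) := by
    rw [y1, y2, h.sq_eq]; field_simp; ring
  unfold modeNorm
  rw [h1, h2, mul_assoc, norm_mul (w ^ 2), norm_pow, mul_add]
  gcongr
  · exact le_mul_of_one_le_left (norm_nonneg _) (le_max_left _ _)
  · exact le_max_right _ _

lemma modeNorm_stepBack (h : Nondegenerate R w lam) (n : ℤ) (han : ‖(a n)⁻¹‖ ≤ R) (x : ℂ × ℂ) :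
    modeNorm w (stepBack a p q w lam n x) ≤
      max 1 (‖w‖ ^ 2) * Real.exp (stepConst R * pert a p q n) * modeNorm w x := by
  have hR := h.one_le
  have h1 := modeNorm_add_le w (stepBack a p q w lam n x - stepBack (fun _ => 1) 0 0 w lam n x)
    (stepBack (fun _ => 1) 0 0 w lam n x)
  rw [sub_add_cancel] at h1
  have h2 := modeNorm_stepBack_sub_free (p := p) (q := q) h n han x
  have h3 := modeNorm_free_step h n x
  have h4 := Real.add_one_le_exp (stepConst R * pert a p q n)
  have hm : (1 : ℝ) ≤ max 1 (‖w‖ ^ 2) := le_max_left _ _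
  set m := max 1 (‖w‖ ^ 2)
  set t := stepConst R * pert a p q n with ht
  have ht0 : 0 ≤ t := mul_nonneg (stepConst_nonneg hR) (pert_nonneg _ _ _ _)
  have hs := modeNorm_nonneg w x
  calc _ ≤ t * modeNorm w x + m * modeNorm w x := by linarith
    _ ≤ m * (t + 1) * modeNorm w x := by nlinarith [mul_nonneg ht0 hs]
    _ ≤ _ := by gcongr

/-- The perturbation contributes factors exp(C `pert`), whose product is bounded independently of k.
Only the free factor can grow with k, and it equals 1 when |w| ≤ 1. -/
lemma modeNorm_backIter (h : Nondegenerate R w lam) (ha : ∀ n, ‖(a n)⁻¹‖ ≤ R)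
    (hs : Summable (pert a p q)) (k : ℕ) (n : ℤ) (x : ℂ × ℂ) :
    modeNorm w (backIter a p q w lam k n x) ≤
      max 1 (‖w‖ ^ 2) ^ k * Real.exp (stepConst R * ∑' m, pert a p q m) * modeNorm w x := by
  have hR := h.one_le
  have hm : (1 : ℝ) ≤ max 1 (‖w‖ ^ 2) := le_max_left _ _
  have main : ∀ n, modeNorm w (backIter a p q w lam k n x) ≤ max 1 (‖w‖ ^ 2) ^ k *
      Real.exp (stepConst R * ∑ i ∈ Finset.range k, pert a p q (n + i)) * modeNorm w x := by
    induction k with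
    | zero => intro n; simp [backIter]
    | succ k ih =>
      intro n
      rw [backIter]
      refine (modeNorm_stepBack h n (ha n) _).trans ?_
      have := ih (n + 1)
      rw [Finset.sum_range_succ', mul_add, Real.exp_add]
      calc _ ≤ max 1 (‖w‖ ^ 2) * Real.exp (stepConst R * pert a p q n) *
            (max 1 (‖w‖ ^ 2) ^ k * Real.exp (stepConst R *
              ∑ i ∈ Finset.range k, pert a p q (n + 1 + i)) * modeNorm w x) := by gcongr
        _ = _ := by
          have : ∀ i : ℕ, n + 1 + (i : ℤ) = n + ((i + 1 : ℕ) : ℤ) := by intro i; push_cast; ring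
          simp only [this, Nat.cast_zero, add_zero]
          ring
  refine (main n).trans ?_
  have hsum : ∑ i ∈ Finset.range k, pert a p q (n + i) ≤ ∑' m, pert a p q m := by
    have inj : Function.Injective fun i : ℕ => n + (i : ℤ) := by
      intro i j hij; simpa using hij
    have := hs.sum_le_tsum ((Finset.range k).map ⟨_, inj⟩) fun _ _ => pert_nonneg _ _ _ _
    rwa [Finset.sum_map] at this
  have := stepConst_nonneg hR
  have := modeNorm_nonneg w x
  gcongr

/-- The state at `n` of the solution which is free from the site `n + k` on. -/
def truncState (a p q : ℤ → ℂ) (w lam : ℂ) (n : ℤ) (k : ℕ) : ℂ × ℂ :=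
  backIter a p q w lam k n (1, 1 + w⁻¹)

lemma truncState_succ (n : ℤ) (k : ℕ) :
    truncState a p q w lam n (k + 1) =
      stepBack a p q w lam n (truncState a p q w lam (n + 1) k) := rfl

/-- The bound for the change of the state when one more site is switched on. -/
def incrConst (R S : ℝ) : ℝ := Real.exp (stepConst R * S) * stepConst R

/-- By linearity the difference is the k-fold transport of the defect of the free state (1, 1 + w⁻¹)
under the single step at n + k. That defect is proportional to the perturbation there. -/
lemma modeNorm_truncState_sub (h : Nondegenerate R w lam) (ha : ∀ n, ‖(a n)⁻¹‖ ≤ R)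
    (hs : Summable (pert a p q)) (n : ℤ) (k : ℕ) :
    modeNorm w (truncState a p q w lam n (k + 1) - truncState a p q w lam n k) ≤
      max 1 (‖w‖ ^ 2) ^ k * (incrConst R (∑' m, pert a p q m) * pert a p q (n + k)) := by
  unfold truncState
  have hw := h.w_ne
  rw [backIter_succ_right, ← backIter_sub]
  refine (modeNorm_backIter h ha hs k n _).trans ?_
  -- (1, 1 + w⁻¹) is the normalized state of (-w)^n, hence fixed by the free step; below, its only
  -- nonzero mode coordinate has modulus 1.
  have hfree : stepBack (fun _ => 1) 0 0 w lam (n + k) (1, 1 + w⁻¹) = (1, 1 + w⁻¹) := by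
    ext
    · simp [stepBack]; field_simp
    · simp [stepBack, h.sq_eq]; field_simp; ring
  have hnorm : modeNorm w (1, 1 + w⁻¹) = 1 := by
    have : (1 + w⁻¹ - (1 + w)) * (w - w⁻¹)⁻¹ = -1 := by
      rw [show 1 + w⁻¹ - (1 + w) = -(w - w⁻¹) by ring, neg_mul, mul_inv_cancel₀ h.sub_ne]
    unfold modeNorm
    simp only [this, mul_one, sub_self, zero_mul, norm_neg, norm_one, norm_zero, add_zero]
  have := modeNorm_stepBack_sub_free (p := p) (q := q) h (n + k) (ha _) (1, 1 + w⁻¹)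
  rw [hfree, hnorm, mul_one] at this
  unfold incrConst
  calc _ ≤ max 1 (‖w‖ ^ 2) ^ k * Real.exp (stepConst R * ∑' m, pert a p q m) *
        (stepConst R * pert a p q (n + k)) := by gcongr
    _ = _ := by ring

end

/-! ### Moments of the perturbation -/

/-- All moments of the perturbation are finite. -/
structure ShortRange (a p q : ℤ → ℂ) : Prop where
  a_ne : ∀ n, a n ≠ 0
  a_moment : ∀ r : ℕ, Summable fun n : ℤ => (1 + |(n : ℝ)|) ^ r * ‖(a n)⁻¹ - 1‖
  p_moment : ∀ r : ℕ, Summable fun n : ℤ => (1 + |(n : ℝ)|) ^ r * ‖p n‖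
  q_moment : ∀ r : ℕ, Summable fun n : ℤ => (1 + |(n : ℝ)|) ^ r * ‖q n‖

lemma summable_moment_exp_neg_rpow {ε δ : ℝ} (hε : 0 < ε) (hδ : 1 / 2 ≤ δ) (r : ℕ) :
    Summable fun n : ℤ => (1 + |(n : ℝ)|) ^ r * Real.exp (-(ε * |(n : ℝ)| ^ δ)) := by
  -- As δ ≥ 1/2, x^{δK} ≥ x^{r+2} for x ≥ 1. The K-th term of the exponential series thus absorbs
  -- the weight and leaves 1/x².
  set K := 2 * (r + 2) with hK
  have hsum : Summable fun n : ℤ => (2 ^ r * (K.factorial / ε ^ K)) * (1 / (n : ℝ) ^ 2) :=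
    (Real.summable_one_div_int_pow.mpr one_lt_two).mul_left _
  refine Summable.of_norm_bounded_eventually hsum ?_
  have hcof : ∀ᶠ n : ℤ in cofinite, n ≠ 0 := by
    have := (Set.finite_singleton (0 : ℤ)).compl_mem_cofinite
    filter_upwards [this] with n hn using hn
  filter_upwards [hcof] with n hn
  have hx : (1 : ℝ) ≤ |(n : ℝ)| := by
    rw [← Int.cast_abs]; exact_mod_cast Int.one_le_abs hn
  rw [← sq_abs (n : ℝ)]
  set x := |(n : ℝ)|
  have hx0 : 0 < x := by linarith
  rw [Real.norm_of_nonneg (by positivity), Real.exp_neg]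
  have h1 : (ε * x ^ δ) ^ K / K.factorial ≤ Real.exp (ε * x ^ δ) :=
    Real.pow_div_factorial_le_exp _ (by positivity) K
  have h2 : x ^ (r + 2) ≤ (x ^ δ) ^ K := by
    rw [← Real.rpow_natCast (x ^ δ), ← Real.rpow_mul hx0.le, ← Real.rpow_natCast x]
    apply Real.rpow_le_rpow_of_exponent_le hx
    rw [hK]; push_cast
    nlinarith
  have h3 : ε ^ K * x ^ (r + 2) / K.factorial ≤ Real.exp (ε * x ^ δ) := by
    refine le_trans ?_ h1
    rw [mul_pow]
    gcongr
  calc (1 + x) ^ r * (Real.exp (ε * x ^ δ))⁻¹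
      ≤ (2 * x) ^ r * (ε ^ K * x ^ (r + 2) / K.factorial)⁻¹ := by
        gcongr
        linarith
    _ = _ := by
      rw [mul_pow, pow_add]
      field_simp

lemma shortRange_of_bddAbove {a p q : ℤ → ℂ} (ha : ∀ n, a n ≠ 0) {ε δ : ℝ} (hε : 0 < ε)
    (hδ : 1 / 2 ≤ δ)
    (hcond : BddAbove (Set.range fun n : ℤ =>
      Real.exp (ε * |(n : ℝ)| ^ δ) * (‖1 - a n‖ + ‖p n‖ + ‖q n‖))) : ShortRange a p q := by
  obtain ⟨M, hM⟩ := hcond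
  have hb : ∀ n : ℤ, ‖1 - a n‖ + ‖p n‖ + ‖q n‖ ≤ M * Real.exp (-(ε * |(n : ℝ)| ^ δ)) := by
    intro n
    have := hM ⟨n, rfl⟩
    rw [Real.exp_neg, ← div_eq_mul_inv, le_div_iff₀ (Real.exp_pos _)]
    linarith
  have key : ∀ u : ℤ → ℝ, (∀ n, 0 ≤ u n) → (∀ n, u n ≤ ‖1 - a n‖ + ‖p n‖ + ‖q n‖) → ∀ r : ℕ,
      Summable fun n : ℤ => (1 + |(n : ℝ)|) ^ r * u n := by
    intro u hu0 hu r
    refine Summable.of_nonneg_of_le (fun n => ?_) (fun n => ?_)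
      ((summable_moment_exp_neg_rpow hε hδ r).mul_left M)
    · have := hu0 n; positivity
    · calc _ ≤ (1 + |(n : ℝ)|) ^ r * (M * Real.exp (-(ε * |(n : ℝ)| ^ δ))) := by
            gcongr
            exact (hu n).trans (hb n)
        _ = _ := by ring
  have hA := key (fun n => ‖1 - a n‖) (fun n => norm_nonneg _)
    (fun n => by linarith [norm_nonneg (p n), norm_nonneg (q n)])
  refine ⟨ha, fun r => ?_, key (fun n => ‖p n‖) (fun n => norm_nonneg _)
    (fun n => by linarith [norm_nonneg (1 - a n), norm_nonneg (q n)]),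
    key (fun n => ‖q n‖) (fun n => norm_nonneg _)
    (fun n => by linarith [norm_nonneg (1 - a n), norm_nonneg (p n)])⟩
  -- Since a_n → 1, |a_n| ≥ 1/2 outside a finite set of sites, which does not affect summability.
  refine Summable.of_norm_bounded_eventually ((hA r).mul_left 2) ?_
  have h0 := (hA 0).tendsto_cofinite_zero
  simp only [pow_zero, one_mul] at h0
  filter_upwards [h0.eventually_le_const (show (0 : ℝ) < 1 / 2 by norm_num)] with n hn
  have h1 : 1 / 2 ≤ ‖a n‖ := by
    have := norm_sub_norm_le (1 : ℂ) (1 - a n)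
    rw [sub_sub_cancel, norm_one] at this
    linarith
  have h2 : ‖(a n)⁻¹‖ ≤ 2 := by
    rw [norm_inv]
    exact inv_le_of_inv_le₀ (by norm_num) (by linarith)
  have h3 : (a n)⁻¹ - 1 = (a n)⁻¹ * (1 - a n) := by
    have := ha n
    field_simp
  rw [Real.norm_of_nonneg (by positivity), h3, norm_mul]
  calc _ ≤ (1 + |(n : ℝ)|) ^ r * (2 * ‖1 - a n‖) := by gcongr
    _ = _ := by ring

section
variable {a p q : ℤ → ℂ}

lemma ShortRange.moment (h : ShortRange a p q) (r : ℕ) :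
    Summable fun n : ℤ => (1 + |(n : ℝ)|) ^ r * pert a p q n := by
  have := ((h.a_moment r).add (h.p_moment r)).add (h.q_moment r)
  refine this.congr fun n => ?_
  unfold pert; ring

lemma ShortRange.summable (h : ShortRange a p q) : Summable (pert a p q) := by
  simpa using h.moment 0

lemma ShortRange.exists_inv_le (h : ShortRange a p q) : ∃ R, ∀ n, ‖(a n)⁻¹‖ ≤ R := by
  refine ⟨1 + ∑' m, pert a p q m, fun n => ?_⟩
  have h1 : pert a p q n ≤ ∑' m, pert a p q m :=
    h.summable.le_tsum n fun _ _ => pert_nonneg _ _ _ _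
  have h2 : ‖(a n)⁻¹ - 1‖ ≤ pert a p q n := by
    unfold pert; linarith [norm_nonneg (p n), norm_nonneg (q n)]
  have h3 := norm_add_le (1 : ℂ) ((a n)⁻¹ - 1)
  rw [add_sub_cancel, norm_one] at h3
  linarith

lemma summable_comp_natCast_add {u : ℤ → ℝ} (hu : Summable u) (n : ℤ) :
    Summable fun k : ℕ => u (n + k) :=
  hu.comp_injective (i := fun k : ℕ => n + (k : ℤ)) fun i j hij => by simpa using hij

lemma tendsto_tail_atTop {u : ℤ → ℝ} :
    Tendsto (fun n : ℤ => ∑' k : ℕ, u (n + k)) atTop (𝓝 0) := by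
  have h1 := tendsto_sum_nat_add (fun k : ℕ => u k)
  have h2 : Tendsto Int.toNat atTop atTop := by
    refine tendsto_atTop_atTop.mpr fun b => ⟨b, fun n hn => ?_⟩
    omega
  refine (h1.comp h2).congr' ?_
  filter_upwards [eventually_ge_atTop 0] with n hn
  simp only [Function.comp]
  congr 1
  ext k
  congr 1
  push_cast
  omega

/-! ### Existence and uniqueness of the Jost solution -/

/-- The normalized Jost solution `f⁺_n / (-w)^n`, as a telescoping series over the cut-offs. -/
def normJost (a p q : ℤ → ℂ) (w lam : ℂ) (n : ℤ) : ℂ :=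
  1 + ∑' k : ℕ, ((truncState a p q w lam n (k + 1)).1 - (truncState a p q w lam n k).1)

variable {R : ℝ} {w lam : ℂ}

lemma norm_truncState_sub_fst_le (h : Nondegenerate R w lam) (ha : ∀ n, ‖(a n)⁻¹‖ ≤ R)
    (hs : Summable (pert a p q)) (n : ℤ) (k : ℕ) :
    ‖(truncState a p q w lam n (k + 1)).1 - (truncState a p q w lam n k).1‖ ≤
      max 1 (‖w‖ ^ 2) ^ k * (incrConst R (∑' m, pert a p q m) * pert a p q (n + k)) := by
  refine le_trans ?_ (modeNorm_truncState_sub h ha hs n k)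
  rw [← Prod.fst_sub]
  exact norm_fst_le_modeNorm h _

lemma norm_truncState_sub_snd_le (h : Nondegenerate R w lam) (ha : ∀ n, ‖(a n)⁻¹‖ ≤ R)
    (hs : Summable (pert a p q)) (n : ℤ) (k : ℕ) :
    ‖(truncState a p q w lam n (k + 1)).2 - (truncState a p q w lam n k).2‖ ≤
      (1 + R) * (max 1 (‖w‖ ^ 2) ^ k *
        (incrConst R (∑' m, pert a p q m) * pert a p q (n + k))) := by
  have := h.one_le
  rw [← Prod.snd_sub]
  refine (norm_snd_le_modeNorm h _).trans ?_
  have := modeNorm_truncState_sub h ha hs n k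
  gcongr

lemma max_one_sq_pow (hw : ‖w‖ ≤ 1) (k : ℕ) : max 1 (‖w‖ ^ 2) ^ k = 1 := by
  rw [max_eq_left (pow_le_one₀ (norm_nonneg _) hw), one_pow]

/-- The state of the normalized Jost solution. -/
lemma exists_jostState (h : Nondegenerate R w lam) (hw : ‖w‖ ≤ 1) (ha : ∀ n, ‖(a n)⁻¹‖ ≤ R)
    (hs : Summable (pert a p q)) :
    ∃ X : ℤ → ℂ × ℂ, (∀ n, (X n).1 = normJost a p q w lam n) ∧
      ∀ n, X n = stepBack a p q w lam n (X (n + 1)) := by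
  have b1 := norm_truncState_sub_fst_le h ha hs
  have b2 := norm_truncState_sub_snd_le h ha hs
  simp only [max_one_sq_pow hw, one_mul] at b1 b2
  have S : ∀ n : ℤ, Summable fun k : ℕ => incrConst R (∑' m, pert a p q m) * pert a p q (n + k) :=
    fun n => (summable_comp_natCast_add hs n).mul_left _
  have s1 := fun n => Summable.of_norm_bounded (S n) (b1 n)
  have s2 := fun n => Summable.of_norm_bounded ((S n).mul_left (1 + R)) (b2 n)
  have t1 : ∀ n, Tendsto (fun k => (truncState a p q w lam n k).1) atTop
      (𝓝 (normJost a p q w lam n)) := by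
    intro n
    have := ((s1 n).hasSum.tendsto_sum_nat).const_add 1
    refine this.congr fun k => ?_
    rw [Finset.sum_range_sub fun k => (truncState a p q w lam n k).1]
    simp [truncState, backIter]
  have t2 : ∀ n, ∃ c, Tendsto (fun k => (truncState a p q w lam n k).2) atTop (𝓝 c) := by
    intro n
    refine ⟨_, (((s2 n).hasSum.tendsto_sum_nat).const_add (1 + w⁻¹)).congr fun k => ?_⟩
    rw [Finset.sum_range_sub fun k => (truncState a p q w lam n k).2]
    simp [truncState, backIter]
  choose c hc using t2
  refine ⟨fun n => (normJost a p q w lam n, c n), fun n => rfl, fun n => ?_⟩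
  have l1 := ((t1 n).prodMk_nhds (hc n)).comp (tendsto_add_atTop_nat 1)
  have l2 := ((t1 (n + 1)).prodMk_nhds (hc (n + 1)))
  have cont : Continuous (stepBack a p q w lam n) := by unfold stepBack; fun_prop
  refine tendsto_nhds_unique l1 (((cont.tendsto _).comp l2).congr fun k => ?_)
  simp only [Function.comp, Prod.mk.eta]
  rw [← truncState_succ]

lemma norm_normJost_sub_one_le (h : Nondegenerate R w lam) (hw : ‖w‖ ≤ 1)
    (ha : ∀ n, ‖(a n)⁻¹‖ ≤ R) (hs : Summable (pert a p q)) (n : ℤ) :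
    ‖normJost a p q w lam n - 1‖ ≤
      incrConst R (∑' m, pert a p q m) * ∑' k : ℕ, pert a p q (n + k) := by
  have b1 := norm_truncState_sub_fst_le h ha hs n
  simp only [max_one_sq_pow hw, one_mul] at b1
  unfold normJost
  rw [add_sub_cancel_left, ← tsum_mul_left]
  exact tsum_of_norm_bounded ((summable_comp_natCast_add hs n).mul_left _).hasSum b1

lemma tendsto_normJost (h : Nondegenerate R w lam) (hw : ‖w‖ ≤ 1)
    (ha : ∀ n, ‖(a n)⁻¹‖ ≤ R) (hs : Summable (pert a p q)) :
    Tendsto (normJost a p q w lam) atTop (𝓝 1) := by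
  rw [tendsto_iff_norm_sub_tendsto_zero]
  refine squeeze_zero (fun _ => norm_nonneg _) (norm_normJost_sub_one_le h hw ha hs) ?_
  simpa using (tendsto_tail_atTop (u := pert a p q)).const_mul
    (incrConst R (∑' m, pert a p q m))

lemma pencil_eq (a p q : ℤ → ℂ) (lam : ℂ) (y : ℤ → ℂ) (n : ℤ) :
    pencil a p q lam y n = a n * (y (n + 1) - y n) - a (n - 1) * (y n - y (n - 1)) +
      (q n + 2 * lam * p n + lam ^ 2) * y n := by
  simp [pencil, fwdDiff]

lemma pencil_of_stepBack (h0 : w ≠ 0) (hane : ∀ n, a n ≠ 0) {X : ℤ → ℂ × ℂ}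
    (hX : ∀ n, X n = stepBack a p q w lam n (X (n + 1))) (n : ℤ) :
    pencil a p q lam (fun n => (-w) ^ n * (X n).1) n = 0 := by
  have hw : -w ≠ 0 := neg_ne_zero.mpr h0
  have key : ∀ n, a n * ((-w) ^ (n + 1) * (X (n + 1)).1 - (-w) ^ n * (X n).1) =
      (-w) ^ (n + 1) * (X (n + 1)).2 := by
    intro n
    have h1 := congrArg Prod.fst (hX n)
    have := hane n
    simp only [stepBack] at h1
    rw [h1, zpow_add_one₀ hw]
    field_simp
    ring
  have h2 := congrArg Prod.snd (hX n)
  have h1 := congrArg Prod.fst (hX n)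
  simp only [stepBack] at h1 h2
  rw [← h1] at h2
  have k2 := key (n - 1)
  rw [sub_add_cancel] at k2
  rw [pencil_eq, key n, k2, h2, zpow_add_one₀ hw]
  ring

lemma stepBack_of_pencil (h0 : w ≠ 0) (hane : ∀ n, a n ≠ 0) {y : ℤ → ℂ}
    (hy : ∀ n, pencil a p q lam y n = 0) (n : ℤ) :
    (fun n => ((y n / (-w) ^ n, a (n - 1) * (y n - y (n - 1)) / (-w) ^ n) : ℂ × ℂ)) n =
      stepBack a p q w lam n ((fun n => ((y n / (-w) ^ n,
        a (n - 1) * (y n - y (n - 1)) / (-w) ^ n) : ℂ × ℂ)) (n + 1)) := by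
  have hw : -w ≠ 0 := neg_ne_zero.mpr h0
  have hz : (-w) ^ n ≠ 0 := zpow_ne_zero _ hw
  have hn := hy n
  have := hane n
  rw [pencil_eq] at hn
  have e1 : y n / (-w) ^ n = -w * (y (n + 1) / (-w) ^ (n + 1) -
      (a n)⁻¹ * (a n * (y (n + 1) - y n) / (-w) ^ (n + 1))) := by
    rw [zpow_add_one₀ hw]
    field_simp
    ring
  ext
  · simp only [stepBack, add_sub_cancel_right]
    exact e1
  · simp only [stepBack, add_sub_cancel_right]
    rw [← e1, show a (n - 1) * (y n - y (n - 1)) = a n * (y (n + 1) - y n) +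
      (q n + 2 * lam * p n + lam ^ 2) * y n by linear_combination -hn, zpow_add_one₀ hw]
    field_simp

lemma eq_backIter {X : ℤ → ℂ × ℂ} (hX : ∀ n, X n = stepBack a p q w lam n (X (n + 1)))
    (k : ℕ) (n : ℤ) : X n = backIter a p q w lam k n (X (n + k)) := by
  induction k generalizing n with
  | zero => simp [backIter]
  | succ k ih =>
    rw [backIter, hX n, ih (n + 1)]
    rw [show n + 1 + (k : ℤ) = n + ((k + 1 : ℕ) : ℤ) by push_cast; ring]

lemma tendsto_a (h : ShortRange a p q) : Tendsto a atTop (𝓝 1) := by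
  have h1 : Tendsto (fun n => ‖(a n)⁻¹ - 1‖) atTop (𝓝 0) := by
    have := (h.a_moment 0).tendsto_cofinite_zero
    simp only [pow_zero, one_mul] at this
    exact this.mono_left atTop_le_cofinite
  have h2 : Tendsto (fun n => (a n)⁻¹) atTop (𝓝 1) := tendsto_iff_norm_sub_tendsto_zero.mpr h1
  simpa using h2.inv₀ one_ne_zero

/-- For |w| ≤ 1 backward transport is bounded uniformly in the number of steps. The normalized state
of the difference tends to 0 at +∞, so it vanishes at every site. -/
lemma eq_of_tendsto (hsr : ShortRange a p q) (h : Nondegenerate R w lam) (hw : ‖w‖ ≤ 1)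
    (ha : ∀ n, ‖(a n)⁻¹‖ ≤ R) {y₁ y₂ : ℤ → ℂ}
    (h₁ : ∀ n, pencil a p q lam y₁ n = 0) (h₂ : ∀ n, pencil a p q lam y₂ n = 0)
    (l₁ : Tendsto (fun n : ℤ => y₁ n / (-w) ^ n) atTop (𝓝 1))
    (l₂ : Tendsto (fun n : ℤ => y₂ n / (-w) ^ n) atTop (𝓝 1)) : y₁ = y₂ := by
  have hR := h.one_le
  have hw0 : -w ≠ 0 := neg_ne_zero.mpr h.w_ne
  set y : ℤ → ℂ := fun n => y₁ n - y₂ n with hy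
  have hp : ∀ n, pencil a p q lam y n = 0 := by
    intro n
    have e1 := h₁ n
    have e2 := h₂ n
    rw [pencil_eq] at e1 e2 ⊢
    simp only [hy]
    linear_combination e1 - e2
  have l : Tendsto (fun n : ℤ => y n / (-w) ^ n) atTop (𝓝 0) := by
    have := l₁.sub l₂
    rw [sub_self] at this
    exact this.congr fun n => by simp only [hy]; ring
  set X := fun n => ((y n / (-w) ^ n, a (n - 1) * (y n - y (n - 1)) / (-w) ^ n) : ℂ × ℂ) with hX
  have hstep : ∀ n, X n = stepBack a p q w lam n (X (n + 1)) :=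
    fun n => stepBack_of_pencil h.w_ne hsr.a_ne hp n
  have lm : Tendsto (fun n : ℤ => n - 1) atTop atTop := tendsto_atTop_add_const_right _ _ tendsto_id
  have lX2 : Tendsto (fun n => (X n).2) atTop (𝓝 0) := by
    have := ((tendsto_a hsr).comp lm).mul (l.add ((l.comp lm).mul_const w⁻¹))
    simp only [zero_mul, add_zero, mul_zero] at this
    refine this.congr fun n => ?_
    simp only [Function.comp, hX]
    rw [zpow_sub_one₀ hw0]
    have := h.w_ne
    have : (-w) ^ n ≠ 0 := zpow_ne_zero _ hw0
    field_simp
    ring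
  have lX : Tendsto (fun n => modeNorm w (X n)) atTop (𝓝 0) := by
    refine squeeze_zero (fun _ => modeNorm_nonneg _ _) (fun n => modeNorm_le h (X n)) ?_
    have := ((l.norm.const_mul (1 + R)).add lX2.norm).const_mul (2 * R)
    simp only [norm_zero, mul_zero, add_zero] at this
    exact this
  have zero : ∀ n, y n = 0 := by
    intro n
    have hb : ∀ k : ℕ, modeNorm w (X n) ≤
        Real.exp (stepConst R * ∑' m, pert a p q m) * modeNorm w (X (n + k)) := by
      intro k
      have := modeNorm_backIter h ha hsr.summable k n (X (n + k))
      rwa [← eq_backIter hstep, max_one_sq_pow hw, one_mul] at this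
    have lk : Tendsto (fun k : ℕ => n + (k : ℤ)) atTop atTop :=
      tendsto_atTop_add_const_left _ _ tendsto_natCast_atTop_atTop
    have lim := (lX.comp lk).const_mul (Real.exp (stepConst R * ∑' m, pert a p q m))
    rw [mul_zero] at lim
    have h0 := ge_of_tendsto' lim hb
    have h1 := (norm_fst_le_modeNorm h (X n)).trans h0
    have h2 : (X n).1 = 0 := norm_le_zero_iff.mp h1
    exact (div_eq_zero_iff.mp h2).resolve_right (zpow_ne_zero _ hw0)
  funext n
  exact sub_eq_zero.mp (zero n)

end

/-! ### The spectral variables z, w and λ -/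

section
variable {a p q : ℤ → ℂ}

lemma free_mode_eq (z : ℂ) (n : ℤ) :
    (-1 : ℂ) ^ n * Complex.exp (Complex.I * n * z) = (-Complex.exp (Complex.I * z)) ^ n := by
  rw [neg_eq_neg_one_mul (Complex.exp _), mul_zpow, ← Complex.exp_int_mul]
  ring_nf

lemma exp_sub_inv (z : ℂ) : Complex.exp (Complex.I * z) - (Complex.exp (Complex.I * z))⁻¹ =
    2 * Complex.I * Complex.sin z := by
  rw [Complex.sin, ← Complex.exp_neg, mul_comm z, show -z * Complex.I = -(Complex.I * z) by ring]
  linear_combination -(Complex.exp (-(Complex.I * z)) - Complex.exp (Complex.I * z)) *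
    Complex.I_sq

lemma two_cos_half_sq (z : ℂ) : (2 * Complex.cos (z / 2)) ^ 2 =
    2 + Complex.exp (Complex.I * z) + (Complex.exp (Complex.I * z))⁻¹ := by
  rw [← Complex.exp_neg, Complex.cos, mul_div_cancel₀ _ two_ne_zero, add_sq, ← Complex.exp_nat_mul,
    ← Complex.exp_nat_mul, mul_assoc, ← Complex.exp_add]
  push_cast
  ring_nf
  rw [Complex.exp_zero]
  ring

/-- The nondegeneracy condition in terms of `z`. -/
abbrev NondegenerateAt (R : ℝ) (z : ℂ) : Prop :=
  Nondegenerate R (Complex.exp (Complex.I * z)) (2 * Complex.cos (z / 2))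

lemma nondegenerateAt_of_sin_ne_zero {z : ℂ} (hz : Complex.sin z ≠ 0) :
    ∃ R, NondegenerateAt R z := by
  set w := Complex.exp (Complex.I * z) with hw
  set l := 2 * Complex.cos (z / 2) with hl
  refine ⟨‖w‖ + ‖w⁻¹‖ + ‖l‖ + ‖(w - w⁻¹)⁻¹‖, Complex.exp_ne_zero _, ?_, two_cos_half_sq z, ?_, ?_,
    ?_, ?_⟩
  · rw [exp_sub_inv]
    simp [hz]
  all_goals linarith [norm_nonneg w, norm_nonneg w⁻¹, norm_nonneg l, norm_nonneg (w - w⁻¹)⁻¹]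

lemma norm_exp_I_mul (z : ℂ) : ‖Complex.exp (Complex.I * z)‖ = Real.exp (-z.im) := by
  rw [Complex.norm_exp]; simp

lemma sin_ne_zero_of_im_ne_zero {z : ℂ} (hz : z.im ≠ 0) : Complex.sin z ≠ 0 := by
  intro h
  obtain ⟨k, hk⟩ := Complex.sin_eq_zero_iff.mp h
  apply hz
  rw [hk]
  simp

/-- The Jost solution as a series. -/
lemma jostPlus_eq (hsr : ShortRange a p q) {z : ℂ} (hz : 0 < z.im) :
    IsJostPlus a p q z (jostPlus a p q z) ∧
    (∀ f, IsJostPlus a p q z f → f = jostPlus a p q z) ∧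
    ∀ n, jostPlus a p q z n = (-Complex.exp (Complex.I * z)) ^ n *
      normJost a p q (Complex.exp (Complex.I * z)) (2 * Complex.cos (z / 2)) n := by
  obtain ⟨R₁, h₁⟩ := nondegenerateAt_of_sin_ne_zero (sin_ne_zero_of_im_ne_zero hz.ne')
  obtain ⟨R₂, h₂⟩ := hsr.exists_inv_le
  have h : NondegenerateAt (max R₁ R₂) z := h₁.mono (le_max_left _ _)
  have ha : ∀ n, ‖(a n)⁻¹‖ ≤ max R₁ R₂ := fun n => (h₂ n).trans (le_max_right _ _)
  have hw : ‖Complex.exp (Complex.I * z)‖ ≤ 1 := by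
    rw [norm_exp_I_mul]; exact Real.exp_le_one_iff.mpr (by linarith)
  have huniq : ∀ f g, IsJostPlus a p q z f → IsJostPlus a p q z g → f = g := by
    rintro f g ⟨hf, lf⟩ ⟨hg, lg⟩
    simp only [free_mode_eq] at lf lg
    exact eq_of_tendsto hsr h hw ha hf hg lf lg
  obtain ⟨X, hX1, hX⟩ := exists_jostState h hw ha hsr.summable
  set w := Complex.exp (Complex.I * z) with hwdef
  have hex : IsJostPlus a p q z fun n =>
      (-w) ^ n * normJost a p q w (2 * Complex.cos (z / 2)) n := by
    refine ⟨fun n => ?_, ?_⟩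
    · have := pencil_of_stepBack h.w_ne hsr.a_ne hX n
      simpa only [hX1] using this
    · simp only [free_mode_eq]
      refine (tendsto_normJost h hw ha hsr.summable).congr fun n => ?_
      rw [← hwdef, mul_div_cancel_left₀]
      exact zpow_ne_zero _ (neg_ne_zero.mpr h.w_ne)
  have hj : IsJostPlus a p q z (jostPlus a p q z) := Classical.epsilon_spec ⟨_, hex⟩
  exact ⟨hj, fun f hf => huniq _ _ hf hj, fun n => congrFun (huniq _ _ hj hex) n⟩

end

/-! ### Local analytic branches of λ ↦ z -/

/-- `Z` is an analytic inverse of `z ↦ 2 cos (z / 2)` on the disc of radius `ρ` about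
`2 cos (z₀ / 2)`, with Lipschitz constant `L` and nondegeneracy constant `R`. -/
structure IsLocalBranch (z₀ : ℂ) (Z : ℂ → ℂ) (ρ L R : ℝ) : Prop where
  rho_pos : 0 < ρ
  L_pos : 0 < L
  map_center : Z (2 * Complex.cos (z₀ / 2)) = z₀
  analytic : ∀ lam ∈ Metric.ball (2 * Complex.cos (z₀ / 2)) ρ, AnalyticAt ℂ Z lam
  right_inv : ∀ lam ∈ Metric.ball (2 * Complex.cos (z₀ / 2)) ρ, 2 * Complex.cos (Z lam / 2) = lam
  nondeg : ∀ lam ∈ Metric.ball (2 * Complex.cos (z₀ / 2)) ρ, NondegenerateAt R (Z lam)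
  lipschitz : ∀ lam ∈ Metric.ball (2 * Complex.cos (z₀ / 2)) ρ,
    ∀ mu ∈ Metric.ball (2 * Complex.cos (z₀ / 2)) ρ, ‖Z lam - Z mu‖ ≤ L * ‖lam - mu‖
  deriv_ne : deriv Z (2 * Complex.cos (z₀ / 2)) ≠ 0
  left_inv : ∀ᶠ z in 𝓝 z₀, Z (2 * Complex.cos (z / 2)) = z

lemma eventually_nondegenerateAt {z₀ : ℂ} (hz : Complex.sin z₀ ≠ 0) :
    ∃ R, ∀ᶠ z in 𝓝 z₀, NondegenerateAt R z := by
  obtain ⟨R, h⟩ := nondegenerateAt_of_sin_ne_zero hz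
  refine ⟨R + 1, ?_⟩
  have c1 : ContinuousAt (fun z : ℂ => Complex.exp (Complex.I * z)) z₀ := by fun_prop
  have c2 := c1.inv₀ h.w_ne
  have c3 : ContinuousAt (fun z : ℂ => 2 * Complex.cos (z / 2)) z₀ := by fun_prop
  have c4 := (c1.sub c2).inv₀ h.sub_ne
  filter_upwards [c1.norm.eventually_le_const (h.w_le.trans_lt (lt_add_one R)),
    c2.norm.eventually_le_const (h.inv_le.trans_lt (lt_add_one R)),
    c3.norm.eventually_le_const (h.lam_le.trans_lt (lt_add_one R)),
    c4.norm.eventually_le_const (h.sub_inv_le.trans_lt (lt_add_one R)),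
    (c1.sub c2).eventually_ne h.sub_ne] with z h1 h2 h3 h4 h5
  exact ⟨Complex.exp_ne_zero _, h5, two_cos_half_sq z, h1, h2, h3, h4⟩

/-- The condition sin z₀ ≠ 0 serves twice: it keeps the two free modes distinct, and it forces
sin(z₀/2) ≠ 0, which makes z ↦ 2 cos(z/2) locally invertible. -/
lemma exists_isLocalBranch {z₀ : ℂ} (hz : Complex.sin z₀ ≠ 0) (R₀ : ℝ) :
    ∃ Z ρ L R, R₀ ≤ R ∧ IsLocalBranch z₀ Z ρ L R := by
  set f : ℂ → ℂ := fun z => 2 * Complex.cos (z / 2) with hf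
  have hfa : AnalyticAt ℂ f z₀ := by
    have : Differentiable ℂ f := by fun_prop
    exact this.analyticAt z₀
  have hderiv : deriv f z₀ = -Complex.sin (z₀ / 2) := by
    have h1 : HasDerivAt f (2 * (-Complex.sin (z₀ / 2) * (1 / 2))) z₀ :=
      (((hasDerivAt_id z₀).div_const 2).ccos).const_mul 2
    rw [h1.deriv]; ring
  have hne : deriv f z₀ ≠ 0 := by
    rw [hderiv, neg_ne_zero]
    intro h0
    apply hz
    rw [show z₀ = 2 * (z₀ / 2) by ring, Complex.sin_two_mul, h0]
    ring
  set Z := HasStrictDerivAt.localInverse f (deriv f z₀) z₀ hfa.hasStrictDerivAt hne with hZ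
  have Za : AnalyticAt ℂ Z (f z₀) := hfa.analyticAt_localInverse hne
  have Zl : ∀ᶠ z in 𝓝 z₀, Z (f z) = z :=
    (hfa.hasStrictDerivAt.hasStrictFDerivAt_equiv hne).eventually_left_inverse
  have Zr : ∀ᶠ l in 𝓝 (f z₀), f (Z l) = l :=
    (hfa.hasStrictDerivAt.hasStrictFDerivAt_equiv hne).eventually_right_inverse
  have Zc : Z (f z₀) = z₀ := Zl.self_of_nhds
  have Zd : deriv Z (f z₀) ≠ 0 := by
    rw [(hfa.hasStrictDerivAt.to_localInverse hne).hasDerivAt.deriv]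
    exact inv_ne_zero hne
  obtain ⟨R, hR⟩ := eventually_nondegenerateAt hz
  have Zn : ∀ᶠ l in 𝓝 (f z₀), NondegenerateAt R (Z l) := by
    have : Tendsto Z (𝓝 (f z₀)) (𝓝 z₀) := by
      have := Za.continuousAt.tendsto
      rwa [Zc] at this
    exact this.eventually hR
  obtain ⟨K, t, ht, hK⟩ := (Za.contDiffAt (n := 1)).exists_lipschitzOnWith
  obtain ⟨ρ, hρ, hball⟩ := Metric.mem_nhds_iff.mp
    (Filter.inter_mem (Filter.inter_mem (Za.eventually_analyticAt) Zr) (Filter.inter_mem Zn ht))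
  refine ⟨Z, ρ, K + 1, max R₀ R, le_max_left _ _, hρ, by positivity, Zc, fun l hl => (hball hl).1.1,
    fun l hl => (hball hl).1.2, fun l hl => Nondegenerate.mono (hball hl).2.1 (le_max_right _ _),
    fun l hl m hm => ?_, Zd, Zl⟩
  have := hK.norm_sub_le (hball hl).2.2 (hball hm).2.2
  refine this.trans ?_
  gcongr
  linarith

/-! ### Differentiating a series up to the boundary -/

/-- Locally uniform limits of holomorphic functions can be differentiated any number of times. -/
lemma TendstoLocallyUniformlyOn.iteratedDeriv_of_isOpen {ι : Type*} {φ : Filter ι}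
    {F : ι → ℂ → ℂ} {f : ℂ → ℂ} {U : Set ℂ} (h : TendstoLocallyUniformlyOn F f φ U)
    (hF : ∀ i, DifferentiableOn ℂ (F i) U) (hU : IsOpen U) (r : ℕ) :
    TendstoLocallyUniformlyOn (fun i => iteratedDeriv r (F i)) (iteratedDeriv r f) φ U := by
  induction r with
  | zero => simpa [iteratedDeriv_zero] using h
  | succ r ih =>
    simp only [iteratedDeriv_succ]
    refine ih.deriv (Eventually.of_forall fun i => ?_) hU
    rw [iteratedDeriv_eq_iterate]
    exact (((hF i).analyticOnNhd hU).iterated_deriv r).differentiableOn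

section
variable {lam₀ : ℂ} {ρ L : ℝ} {Z : ℂ → ℂ} {d : ℕ → ℂ → ℂ} {M : ℕ → ℝ}

/-- The constant in the Cauchy estimates for the `r`-th derivative. -/
def cauchyConst (ρ L : ℝ) (r : ℕ) : ℝ := r.factorial / (min (ρ / 4) (1 / L)) ^ r

lemma cauchyConst_nonneg (hρ : 0 < ρ) (hL : 0 < L) (r : ℕ) : 0 ≤ cauchyConst ρ L r := by
  have : 0 < min (ρ / 4) (1 / L) := lt_min (by positivity) (by positivity)
  unfold cauchyConst
  positivity

/-- Cauchy estimates up to the curve `Im Z = 0` for functions that are bounded a little beyond. -/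
lemma norm_iteratedDeriv_le_of_im_bound (hρ : 0 < ρ) (hL : 0 < L)
    (hZ : ∀ l ∈ Metric.ball lam₀ ρ, ∀ m ∈ Metric.ball lam₀ ρ, ‖Z l - Z m‖ ≤ L * ‖l - m‖)
    (hd : ∀ k, DifferentiableOn ℂ (d k) (Metric.ball lam₀ ρ))
    (hM : ∀ k : ℕ, ∀ l ∈ Metric.ball lam₀ ρ, -(1 / ((k : ℝ) + 1)) ≤ (Z l).im → ‖d k l‖ ≤ M k)
    (r k : ℕ) {l : ℂ} (hl : l ∈ Metric.ball lam₀ (ρ / 2)) (him : 0 ≤ (Z l).im) :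
    ‖iteratedDeriv r (d k) l‖ ≤ cauchyConst ρ L r * (((k : ℝ) + 1) ^ r * M k) := by
  -- The Cauchy radius is c/(k + 1). The bound ρ/4 keeps the disc inside the ball of radius ρ; the
  -- bound 1/L lets Im Z drop by at most 1/(k + 1), where the estimate for the k-th term still
  -- holds.
  set c := min (ρ / 4) (1 / L) with hc
  have hc0 : 0 < c := lt_min (by positivity) (by positivity)
  have hk : (1 : ℝ) ≤ (k : ℝ) + 1 := by linarith [(Nat.cast_nonneg k : (0 : ℝ) ≤ k)]
  set s := c / ((k : ℝ) + 1) with hs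
  have hs0 : 0 < s := by positivity
  have hs1 : s ≤ ρ / 4 := (div_le_self hc0.le hk).trans (min_le_left _ _)
  have hs2 : L * s ≤ 1 / ((k : ℝ) + 1) := by
    rw [hs, ← mul_div_assoc]
    gcongr
    calc L * c ≤ L * (1 / L) := by gcongr; exact min_le_right _ _
      _ = 1 := by field_simp
  have hsub : Metric.closedBall l s ⊆ Metric.ball lam₀ ρ := by
    intro m hm
    rw [Metric.mem_closedBall] at hm
    rw [Metric.mem_ball] at hl ⊢
    linarith [dist_triangle m l lam₀]
  have hll : l ∈ Metric.ball lam₀ ρ := hsub (Metric.mem_closedBall_self hs0.le)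
  have hdc : DiffContOnCl ℂ (d k) (Metric.ball l s) := by
    refine DifferentiableOn.diffContOnCl ?_
    rw [closure_ball l hs0.ne']
    exact (hd k).mono hsub
  have := Complex.norm_iteratedDeriv_le_of_forall_mem_sphere_norm_le (C := M k) r hs0 hdc ?_
  · refine this.trans (le_of_eq ?_)
    rw [hs, cauchyConst, ← hc, div_pow]
    field_simp
  · intro m hm
    have hmb := hsub (Metric.sphere_subset_closedBall hm)
    refine hM k m hmb ?_
    have h1 := hZ m hmb l hll
    rw [mem_sphere_iff_norm.mp hm] at h1
    have h2 := Complex.abs_im_le_norm (Z m - Z l)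
    rw [Complex.sub_im] at h2
    have h3 := abs_le.mp h2
    linarith [h3.1]

/-- The Weierstrass test applies on the closed side because every single term is analytic on the
whole ball. -/
lemma continuousOn_tsum_iteratedDeriv (hρ : 0 < ρ) (hL : 0 < L)
    (hZ : ∀ l ∈ Metric.ball lam₀ ρ, ∀ m ∈ Metric.ball lam₀ ρ, ‖Z l - Z m‖ ≤ L * ‖l - m‖)
    (hd : ∀ k, DifferentiableOn ℂ (d k) (Metric.ball lam₀ ρ))
    (hM : ∀ k : ℕ, ∀ l ∈ Metric.ball lam₀ ρ, -(1 / ((k : ℝ) + 1)) ≤ (Z l).im → ‖d k l‖ ≤ M k)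
    (r : ℕ) (hs : Summable fun k : ℕ => ((k : ℝ) + 1) ^ r * M k) :
    ContinuousOn (fun l => ∑' k, iteratedDeriv r (d k) l)
      (Metric.ball lam₀ (ρ / 2) ∩ {l | 0 ≤ (Z l).im}) := by
  refine continuousOn_tsum (fun k => ?_) (hs.mul_left (cauchyConst ρ L r)) fun k l hl =>
    norm_iteratedDeriv_le_of_im_bound hρ hL hZ hd hM r k hl.1 hl.2
  rw [iteratedDeriv_eq_iterate]
  refine ((((hd k).analyticOnNhd Metric.isOpen_ball).iterated_deriv r).continuousOn).mono ?_
  exact fun l hl => Metric.ball_subset_ball (by linarith) hl.1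

lemma analyticAt_tsum_and_iteratedDeriv (hρ : 0 < ρ) (hL : 0 < L)
    (hZ : ∀ l ∈ Metric.ball lam₀ ρ, ∀ m ∈ Metric.ball lam₀ ρ, ‖Z l - Z m‖ ≤ L * ‖l - m‖)
    (hd : ∀ k, DifferentiableOn ℂ (d k) (Metric.ball lam₀ ρ))
    (hM : ∀ k : ℕ, ∀ l ∈ Metric.ball lam₀ ρ, -(1 / ((k : ℝ) + 1)) ≤ (Z l).im → ‖d k l‖ ≤ M k)
    (hs : Summable M) {l : ℂ} (hl : l ∈ Metric.ball lam₀ (ρ / 2)) (him : 0 < (Z l).im) :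
    AnalyticAt ℂ (fun l => ∑' k, d k l) l ∧
      ∀ r, iteratedDeriv r (fun l => ∑' k, d k l) l = ∑' k, iteratedDeriv r (d k) l := by
  have hZc : ContinuousOn Z (Metric.ball lam₀ (ρ / 2)) := by
    have : LipschitzOnWith L.toNNReal Z (Metric.ball lam₀ (ρ / 2)) := by
      refine LipschitzOnWith.of_dist_le_mul fun x hx y hy => ?_
      rw [dist_eq_norm, dist_eq_norm, Real.coe_toNNReal _ hL.le]
      exact hZ x (Metric.ball_subset_ball (by linarith) hx) y
        (Metric.ball_subset_ball (by linarith) hy)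
    exact this.continuousOn
  set U := Metric.ball lam₀ (ρ / 2) ∩ Z ⁻¹' {z | 0 < z.im} with hUdef
  have hU : IsOpen U := hZc.isOpen_inter_preimage Metric.isOpen_ball
    (isOpen_lt continuous_const Complex.continuous_im)
  have hlU : l ∈ U := ⟨hl, him⟩
  have hdU : ∀ k, DifferentiableOn ℂ (d k) U := fun k =>
    (hd k).mono fun m hm => Metric.ball_subset_ball (by linarith) hm.1
  have hb : ∀ k, ∀ m ∈ U, ‖d k m‖ ≤ M k := fun k m hm =>
    hM k m (Metric.ball_subset_ball (by linarith) hm.1)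
      ((neg_nonpos.mpr (by positivity)).trans (le_of_lt hm.2))
  have hunif := (tendstoUniformlyOn_tsum hs hb).tendstoLocallyUniformlyOn
  have hdiff : ∀ t : Finset ℕ, DifferentiableOn ℂ (fun x => ∑ k ∈ t, d k x) U := fun t =>
    DifferentiableOn.fun_sum fun k _ => hdU k
  refine ⟨(hunif.differentiableOn (Eventually.of_forall hdiff) hU).analyticAt
    (hU.mem_nhds hlU), fun r => ?_⟩
  have hr := (hunif.iteratedDeriv_of_isOpen hdiff hU r).tendsto_at hlU
  have hsum : HasSum (fun k => iteratedDeriv r (d k) l)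
      (iteratedDeriv r (fun l => ∑' k, d k l) l) := by
    refine hr.congr fun t => ?_
    have : (fun x => ∑ k ∈ t, d k x) = ∑ k ∈ t, d k := by ext; simp
    rw [this, iteratedDeriv_sum]
    exact fun k _ => ((hdU k).analyticAt (hU.mem_nhds hlU)).contDiffAt
  exact hsum.tsum_eq.symm

end

/-! ### Derivatives of the normalized Jost solution -/

section
variable {a p q : ℤ → ℂ}

/-- The change of the normalized solution at `n` when the perturbation is switched on at the site
`n + k`, as a function of `z`. -/
def jostIncr (a p q : ℤ → ℂ) (n : ℤ) (k : ℕ) (z : ℂ) : ℂ :=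
  (truncState a p q (Complex.exp (Complex.I * z)) (2 * Complex.cos (z / 2)) n (k + 1)).1 -
    (truncState a p q (Complex.exp (Complex.I * z)) (2 * Complex.cos (z / 2)) n k).1

lemma differentiable_truncState (n : ℤ) (k : ℕ) :
    Differentiable ℂ (fun z : ℂ => (truncState a p q (Complex.exp (Complex.I * z))
      (2 * Complex.cos (z / 2)) n k).1) ∧
    Differentiable ℂ (fun z : ℂ => (truncState a p q (Complex.exp (Complex.I * z))
      (2 * Complex.cos (z / 2)) n k).2) := by
  induction k generalizing n with
  | zero =>
    simp only [truncState, backIter, ← Complex.exp_neg]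
    constructor <;> fun_prop
  | succ k ih =>
    obtain ⟨h1, h2⟩ := ih (n + 1)
    simp only [truncState_succ, stepBack]
    constructor <;> fun_prop

lemma differentiable_jostIncr (n : ℤ) (k : ℕ) : Differentiable ℂ (jostIncr a p q n k) :=
  (differentiable_truncState n (k + 1)).1.sub (differentiable_truncState n k).1

/-- Only k backward steps are involved. If Im z ≥ -1/(k + 1), each has free factor at most
e^{2/(k+1)}, and the product is at most e². The admissible half-plane thus exceeds the closed upper
one by an amount that shrinks only like 1/k. -/
lemma norm_jostIncr_le {R : ℝ} (hsr : ShortRange a p q) (ha : ∀ n, ‖(a n)⁻¹‖ ≤ R) {z : ℂ}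
    (h : NondegenerateAt R z) (n : ℤ) (k : ℕ) (hz : -(1 / ((k : ℝ) + 1)) ≤ z.im) :
    ‖jostIncr a p q n k z‖ ≤
      Real.exp 2 * (incrConst R (∑' m, pert a p q m) * pert a p q (n + k)) := by
  have hR := h.one_le
  refine (norm_truncState_sub_fst_le h ha hsr.summable n k).trans ?_
  have h1 : 0 ≤ incrConst R (∑' m, pert a p q m) * pert a p q (n + k) := by
    unfold incrConst
    have := stepConst_nonneg hR
    have := pert_nonneg a p q (n + k)
    positivity
  gcongr
  have hk : (0 : ℝ) < (k : ℝ) + 1 := by positivity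
  have h2 : max 1 (‖Complex.exp (Complex.I * z)‖ ^ 2) ≤ Real.exp (2 / ((k : ℝ) + 1)) := by
    refine max_le (Real.one_le_exp (by positivity)) ?_
    rw [norm_exp_I_mul, ← Real.exp_nat_mul]
    apply Real.exp_le_exp.mpr
    have : (2 : ℝ) / (k + 1) = 2 * (1 / (k + 1)) := by ring
    push_cast
    linarith
  calc _ ≤ Real.exp (2 / ((k : ℝ) + 1)) ^ k := by gcongr
    _ = Real.exp (k * (2 / ((k : ℝ) + 1))) := by rw [← Real.exp_nat_mul]
    _ ≤ Real.exp 2 := by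
      apply Real.exp_le_exp.mpr
      rw [← mul_div_assoc, div_le_iff₀ hk]
      linarith

/-- The `r`-th derivative of the normalized solution in the variable `lam`, up to the boundary. -/
def jostDeriv (a p q : ℤ → ℂ) (Z : ℂ → ℂ) (r : ℕ) (n : ℤ) (l : ℂ) : ℂ :=
  (if r = 0 then 1 else 0) + ∑' k, iteratedDeriv r (fun l => jostIncr a p q n k (Z l)) l

/-- Trades the distance k from the site n for the distance of n + k from the origin, where the
moments are taken. The price (1 + |n|)^r is the growth allowed towards -∞. -/
lemma moment_shift_le (r : ℕ) (n : ℤ) (k : ℕ) :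
    ((k : ℝ) + 1) ^ r ≤ (1 + |(n : ℝ)|) ^ r * (1 + |((n + k : ℤ) : ℝ)|) ^ r := by
  rw [← mul_pow]
  gcongr
  push_cast
  have h1 : (k : ℝ) ≤ |(n : ℝ)| + |(n : ℝ) + k| := by
    have := abs_sub ((n : ℝ) + k) n
    rw [add_sub_cancel_left, abs_of_nonneg (Nat.cast_nonneg k : (0 : ℝ) ≤ k)] at this
    linarith
  nlinarith [mul_nonneg (abs_nonneg (n : ℝ)) (abs_nonneg ((n : ℝ) + k))]

lemma ShortRange.summable_shift (h : ShortRange a p q) (r : ℕ) (n : ℤ) :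
    Summable fun k : ℕ => ((k : ℝ) + 1) ^ r * pert a p q (n + k) := by
  refine Summable.of_nonneg_of_le (fun k => ?_) (fun k => ?_)
    ((summable_comp_natCast_add (h.moment r) n).mul_left ((1 + |(n : ℝ)|) ^ r))
  · have := pert_nonneg a p q (n + k); positivity
  · have := pert_nonneg a p q (n + k)
    have := moment_shift_le r n k
    rw [← mul_assoc]
    gcongr

lemma tsum_comp_natCast_add_le {u : ℤ → ℝ} (h0 : ∀ m, 0 ≤ u m) (hu : Summable u) (n : ℤ) :
    ∑' k : ℕ, u (n + k) ≤ ∑' m, u m :=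
  tsum_comp_le_tsum_of_inj hu h0 (i := fun k : ℕ => n + (k : ℤ))
    fun i j hij => by simpa using hij

lemma ShortRange.tsum_shift_le (h : ShortRange a p q) (r : ℕ) (n : ℤ) :
    ∑' k : ℕ, ((k : ℝ) + 1) ^ r * pert a p q (n + k) ≤
      (1 + |(n : ℝ)|) ^ r * ∑' m : ℤ, (1 + |(m : ℝ)|) ^ r * pert a p q m := by
  have h0 : ∀ m : ℤ, 0 ≤ (1 + |(m : ℝ)|) ^ r * pert a p q m := fun m => by
    have := pert_nonneg a p q m; positivity
  have h1 : ∑' k : ℕ, (1 + |((n + k : ℤ) : ℝ)|) ^ r * pert a p q (n + k) ≤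
      ∑' m : ℤ, (1 + |(m : ℝ)|) ^ r * pert a p q m :=
    tsum_comp_natCast_add_le h0 (h.moment r) n
  calc _ ≤ ∑' k : ℕ, (1 + |(n : ℝ)|) ^ r *
        ((1 + |((n + k : ℤ) : ℝ)|) ^ r * pert a p q (n + k)) := by
        refine (h.summable_shift r n).tsum_le_tsum (fun k => ?_)
          ((summable_comp_natCast_add (h.moment r) n).mul_left _)
        have := pert_nonneg a p q (n + k)
        have := moment_shift_le r n k
        rw [← mul_assoc]
        gcongr
    _ ≤ _ := by
      rw [tsum_mul_left]
      gcongr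

/-- To the right of the origin k ≤ n + k, so no factor growing in n is lost. The exact asymptotics
at +∞ depend on this. -/
lemma ShortRange.tsum_shift_le_of_nonneg (h : ShortRange a p q) (r : ℕ) {n : ℤ} (hn : 0 ≤ n) :
    ∑' k : ℕ, ((k : ℝ) + 1) ^ r * pert a p q (n + k) ≤
      ∑' k : ℕ, (1 + |((n + k : ℤ) : ℝ)|) ^ r * pert a p q (n + k) := by
  refine (h.summable_shift r n).tsum_le_tsum (fun k => ?_)
    (summable_comp_natCast_add (h.moment r) n)
  have := pert_nonneg a p q (n + k)
  have hn' : (0 : ℝ) ≤ n := by exact_mod_cast hn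
  have h1 : (k : ℝ) + 1 ≤ 1 + |((n + k : ℤ) : ℝ)| := by
    push_cast
    rw [abs_of_nonneg (by positivity)]
    linarith
  gcongr

variable {z₀ : ℂ} {Z : ℂ → ℂ} {ρ L R : ℝ}

/-- The closed side of the disc on which boundary values are taken. -/
def closedSide (z₀ : ℂ) (Z : ℂ → ℂ) (ρ : ℝ) : Set ℂ :=
  Metric.ball (2 * Complex.cos (z₀ / 2)) (ρ / 2) ∩ {l | 0 ≤ (Z l).im}

lemma jostIncr_branch_le (hsr : ShortRange a p q) (ha : ∀ n, ‖(a n)⁻¹‖ ≤ R) (hB : IsLocalBranch z₀ Z ρ L R)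
    (n : ℤ) (k : ℕ) : ∀ l ∈ Metric.ball (2 * Complex.cos (z₀ / 2)) ρ,
    -(1 / ((k : ℝ) + 1)) ≤ (Z l).im → ‖jostIncr a p q n k (Z l)‖ ≤
      Real.exp 2 * (incrConst R (∑' m, pert a p q m) * pert a p q (n + k)) :=
  fun l hl him => norm_jostIncr_le hsr ha (hB.nondeg l hl) n k him

lemma jostIncr_branch_differentiableOn (hB : IsLocalBranch z₀ Z ρ L R)
    (n : ℤ) (k : ℕ) :
    DifferentiableOn ℂ (fun l => jostIncr a p q n k (Z l))
      (Metric.ball (2 * Complex.cos (z₀ / 2)) ρ) := fun l hl =>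
  (((differentiable_jostIncr n k) _).comp l (hB.analytic l hl).differentiableAt).differentiableWithinAt

lemma summable_jostIncr_bound (hsr : ShortRange a p q)
    (r : ℕ) (n : ℤ) : Summable fun k : ℕ => ((k : ℝ) + 1) ^ r *
    (Real.exp 2 * (incrConst R (∑' m, pert a p q m) * pert a p q (n + k))) := by
  refine ((hsr.summable_shift r n).mul_left
    (Real.exp 2 * incrConst R (∑' m, pert a p q m))).congr fun k => ?_
  ring

lemma analyticAt_normJost_branch (hsr : ShortRange a p q) (ha : ∀ n, ‖(a n)⁻¹‖ ≤ R) (hB : IsLocalBranch z₀ Z ρ L R)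
    (n : ℤ) {l : ℂ}
    (hl : l ∈ Metric.ball (2 * Complex.cos (z₀ / 2)) (ρ / 2)) (him : 0 < (Z l).im) :
    AnalyticAt ℂ (fun l => 1 + ∑' k, jostIncr a p q n k (Z l)) l ∧
      ∀ r, iteratedDeriv r (fun l => 1 + ∑' k, jostIncr a p q n k (Z l)) l =
        jostDeriv a p q Z r n l := by
  have hs : Summable fun k : ℕ =>
      Real.exp 2 * (incrConst R (∑' m, pert a p q m) * pert a p q (n + k)) := by
    simpa using summable_jostIncr_bound (R := R) hsr 0 n
  obtain ⟨h1, h2⟩ := analyticAt_tsum_and_iteratedDeriv hB.rho_pos hB.L_pos hB.lipschitz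
    (jostIncr_branch_differentiableOn hB n) (jostIncr_branch_le hsr ha hB n) hs hl him
  refine ⟨analyticAt_const.add h1, fun r => ?_⟩
  rw [iteratedDeriv_fun_add contDiffAt_const h1.contDiffAt, h2 r, iteratedDeriv_const, jostDeriv]

lemma continuousOn_jostDeriv (hsr : ShortRange a p q) (ha : ∀ n, ‖(a n)⁻¹‖ ≤ R) (hB : IsLocalBranch z₀ Z ρ L R)
    (r : ℕ) (n : ℤ) :
    ContinuousOn (jostDeriv a p q Z r n) (closedSide z₀ Z ρ) :=
  continuousOn_const.add (continuousOn_tsum_iteratedDeriv hB.rho_pos hB.L_pos hB.lipschitz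
    (jostIncr_branch_differentiableOn hB n) (jostIncr_branch_le hsr ha hB n) r
    (summable_jostIncr_bound (R := R) hsr r n))

lemma exists_norm_jostDeriv_sub_le (hsr : ShortRange a p q) (ha : ∀ n, ‖(a n)⁻¹‖ ≤ R) (hB : IsLocalBranch z₀ Z ρ L R)
    (r : ℕ) : ∃ C, 0 ≤ C ∧ ∀ n, ∀ l ∈ closedSide z₀ Z ρ,
    ‖jostDeriv a p q Z r n l - (if r = 0 then 1 else 0)‖ ≤
      C * ∑' k : ℕ, ((k : ℝ) + 1) ^ r * pert a p q (n + k) := by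
  have hR : 1 ≤ R := (hB.nondeg _ (Metric.mem_ball_self hB.rho_pos)).one_le
  have := cauchyConst_nonneg hB.rho_pos hB.L_pos r
  have := stepConst_nonneg hR
  refine ⟨cauchyConst ρ L r * (Real.exp 2 * incrConst R (∑' m, pert a p q m)),
    by unfold incrConst; positivity, fun n l hl => ?_⟩
  rw [jostDeriv, add_sub_cancel_left, ← tsum_mul_left]
  refine tsum_of_norm_bounded ((hsr.summable_shift r n).mul_left _).hasSum fun k => ?_
  refine (norm_iteratedDeriv_le_of_im_bound hB.rho_pos hB.L_pos hB.lipschitz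
    (jostIncr_branch_differentiableOn hB n) (jostIncr_branch_le hsr ha hB n) r k
    hl.1 hl.2).trans (le_of_eq ?_)
  ring

lemma exists_norm_jostDeriv_le (hsr : ShortRange a p q) (ha : ∀ n, ‖(a n)⁻¹‖ ≤ R) (hB : IsLocalBranch z₀ Z ρ L R)
    (r : ℕ) : ∃ C, 0 ≤ C ∧ ∀ n, ∀ l ∈ closedSide z₀ Z ρ,
    ‖jostDeriv a p q Z r n l‖ ≤ C * (1 + |(n : ℝ)|) ^ r := by
  obtain ⟨C, hC, h⟩ := exists_norm_jostDeriv_sub_le hsr ha hB r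
  have hM : 0 ≤ ∑' m : ℤ, (1 + |(m : ℝ)|) ^ r * pert a p q m := tsum_nonneg fun m => by
    have := pert_nonneg a p q m; positivity
  refine ⟨1 + C * ∑' m : ℤ, (1 + |(m : ℝ)|) ^ r * pert a p q m, by positivity, fun n l hl => ?_⟩
  have h1 := norm_add_le (jostDeriv a p q Z r n l - (if r = 0 then 1 else 0))
    (if r = 0 then 1 else 0)
  rw [sub_add_cancel] at h1
  have h2 : ‖(if r = 0 then 1 else 0 : ℂ)‖ ≤ 1 := by split_ifs <;> simp
  have h3 := h n l hl
  have h4 := mul_le_mul_of_nonneg_left (hsr.tsum_shift_le r n) hC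
  have h5 : (1 : ℝ) ≤ (1 + |(n : ℝ)|) ^ r := one_le_pow₀ (by linarith [abs_nonneg (n : ℝ)])
  calc _ ≤ C * ((1 + |(n : ℝ)|) ^ r * ∑' m : ℤ, (1 + |(m : ℝ)|) ^ r * pert a p q m) +
        (1 + |(n : ℝ)|) ^ r := by linarith
    _ = _ := by ring

lemma exists_norm_jostDeriv_le_of_nonneg (hsr : ShortRange a p q) (ha : ∀ n, ‖(a n)⁻¹‖ ≤ R) (hB : IsLocalBranch z₀ Z ρ L R)
    (r : ℕ) : ∃ C, 0 ≤ C ∧ ∀ n, 0 ≤ n →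
    ∀ l ∈ closedSide z₀ Z ρ, ‖jostDeriv a p q Z r n l‖ ≤ C := by
  obtain ⟨C, hC, h⟩ := exists_norm_jostDeriv_sub_le hsr ha hB r
  have hp : ∀ m : ℤ, 0 ≤ (1 + |(m : ℝ)|) ^ r * pert a p q m := fun m => by
    have := pert_nonneg a p q m; positivity
  have hM : 0 ≤ ∑' m : ℤ, (1 + |(m : ℝ)|) ^ r * pert a p q m := tsum_nonneg hp
  refine ⟨1 + C * ∑' m : ℤ, (1 + |(m : ℝ)|) ^ r * pert a p q m, by positivity,
    fun n hn l hl => ?_⟩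
  have h1 := norm_add_le (jostDeriv a p q Z r n l - (if r = 0 then 1 else 0))
    (if r = 0 then 1 else 0)
  rw [sub_add_cancel] at h1
  have h2 : ‖(if r = 0 then 1 else 0 : ℂ)‖ ≤ 1 := by split_ifs <;> simp
  have h3 := h n l hl
  have h5 : ∑' k : ℕ, (1 + |((n + k : ℤ) : ℝ)|) ^ r * pert a p q (n + k) ≤
      ∑' m : ℤ, (1 + |(m : ℝ)|) ^ r * pert a p q m :=
    tsum_comp_natCast_add_le hp (hsr.moment r) n
  have h4 := mul_le_mul_of_nonneg_left ((hsr.tsum_shift_le_of_nonneg r hn).trans h5) hC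
  linarith

lemma tendsto_jostDeriv_zero (hsr : ShortRange a p q) (ha : ∀ n, ‖(a n)⁻¹‖ ≤ R) (hB : IsLocalBranch z₀ Z ρ L R)
    {l : ℂ} (hl : l ∈ closedSide z₀ Z ρ) :
    Tendsto (fun n => jostDeriv a p q Z 0 n l) atTop (𝓝 1) := by
  obtain ⟨C, hC, h⟩ := exists_norm_jostDeriv_sub_le hsr ha hB 0
  rw [tendsto_iff_norm_sub_tendsto_zero]
  refine squeeze_zero (fun _ => norm_nonneg _) (fun n => by simpa using h n l hl) ?_
  simpa using (tendsto_tail_atTop (u := pert a p q)).const_mul C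


end

/-! ### Independence of the choice of branch -/

section
variable {a p q : ℤ → ℂ}

lemma exists_branch_point {lam : ℂ} (h : lam ∈ Theta) :
    ∃ z : ℂ, 0 < z.im ∧ 2 * Complex.cos (z / 2) = lam := by
  obtain ⟨y, hy⟩ := Complex.cos_surjective (lam / 2)
  have hy0 : y.im ≠ 0 := by
    intro h0
    apply h
    refine ⟨2 * Real.cos y.re, ?_, ?_⟩
    · constructor <;> linarith [Real.neg_one_le_cos y.re, Real.cos_le_one y.re]
    · have : y = (y.re : ℂ) := Complex.ext rfl (by simp [h0])
      rw [this] at hy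
      push_cast
      rw [hy]; ring
  rcases lt_or_gt_of_ne hy0 with h1 | h1
  · refine ⟨-(2 * y), by simp; linarith, ?_⟩
    rw [show -(2 * y) / 2 = -y by ring, Complex.cos_neg, hy]; ring
  · refine ⟨2 * y, by simp; linarith, ?_⟩
    rw [show (2 * y) / 2 = y by ring, hy]; ring

/-- The value 2 cos(z/2) determines z up to sign and translation by 4π; Im z > 0 fixes the sign. -/
lemma twoArccosHalf_spec {z : ℂ} (hz : 0 < z.im) :
    0 < (twoArccosHalf (2 * Complex.cos (z / 2))).im ∧
    ∃ k : ℤ, twoArccosHalf (2 * Complex.cos (z / 2)) = z + 4 * k * Real.pi := by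
  have hex : ∃ z' : ℂ, 0 < z'.im ∧ -Real.pi < z'.re ∧ z'.re ≤ 3 * Real.pi ∧
      2 * Complex.cos (z' / 2) = 2 * Complex.cos (z / 2) := by
    have hp : (0 : ℝ) < 4 * Real.pi := by positivity
    set k := toIocDiv hp (-Real.pi) z.re with hk
    have hm := toIocMod_mem_Ioc hp (-Real.pi) z.re
    rw [← self_sub_toIocDiv_zsmul, ← hk, zsmul_eq_mul] at hm
    have e : z - (k : ℂ) * (4 * Real.pi) = z - ((k * (4 * Real.pi) : ℝ) : ℂ) := by push_cast; ring
    refine ⟨z - k * (4 * Real.pi), ?_, ?_, ?_, ?_⟩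
    · rw [e, Complex.sub_im, Complex.ofReal_im, sub_zero]; exact hz
    · rw [e, Complex.sub_re, Complex.ofReal_re]; exact hm.1
    · rw [e, Complex.sub_re, Complex.ofReal_re]; linarith [hm.2]
    · rw [show (z - k * (4 * Real.pi)) / 2 = z / 2 - k * (2 * Real.pi) by ring,
        Complex.cos_sub_int_mul_two_pi]
  obtain ⟨h1, h2, h3, h4⟩ := Classical.epsilon_spec hex
  refine ⟨h1, ?_⟩
  change 0 < (twoArccosHalf (2 * Complex.cos (z / 2))).im at h1
  change 2 * Complex.cos ((twoArccosHalf (2 * Complex.cos (z / 2))) / 2) = _ at h4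
  set z' := twoArccosHalf (2 * Complex.cos (z / 2))
  obtain ⟨k, hk | hk⟩ := Complex.cos_eq_cos_iff.mp (mul_left_cancel₀ two_ne_zero h4)
  · refine ⟨-k, ?_⟩
    push_cast
    linear_combination -2 * hk
  · exfalso
    have h5 := congrArg Complex.im hk
    have e : (2 * (k : ℂ) * Real.pi - z' / 2).im = -(z'.im / 2) := by
      have e1 : 2 * (k : ℂ) * Real.pi = ((2 * k * Real.pi : ℝ) : ℂ) := by push_cast; ring
      rw [e1, Complex.sub_im, Complex.ofReal_im]
      simp
    have e2 : (z / 2).im = z.im / 2 := by simp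
    rw [e, e2] at h5
    linarith

/-- The Jost conditions are invariant under z ↦ z + 4π, so the jump of the chosen branch is
invisible in F⁺, which may be computed along any local branch in the upper half-plane. -/
lemma FPlus_two_cos {z : ℂ} (hz : 0 < z.im) (n : ℤ) :
    FPlus a p q n (2 * Complex.cos (z / 2)) = jostPlus a p q z n := by
  obtain ⟨-, k, hk⟩ := twoArccosHalf_spec hz
  have h1 : 2 * Complex.cos ((z + 4 * k * Real.pi) / 2) = 2 * Complex.cos (z / 2) := by
    rw [show (z + 4 * k * Real.pi) / 2 = z / 2 + k * (2 * Real.pi) by ring,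
      Complex.cos_add_int_mul_two_pi]
  have h2 : ∀ n : ℤ, Complex.exp (Complex.I * n * (z + 4 * k * Real.pi)) =
      Complex.exp (Complex.I * n * z) := by
    intro n
    rw [show Complex.I * n * (z + 4 * k * Real.pi) =
      Complex.I * n * z + ((2 * n * k : ℤ) : ℂ) * (2 * Real.pi * Complex.I) by push_cast; ring,
      Complex.exp_add, Complex.exp_int_mul_two_pi_mul_I, mul_one]
  have h3 : IsJostPlus a p q (z + 4 * k * Real.pi) = IsJostPlus a p q z := by
    funext f
    simp only [IsJostPlus, h1, h2]
  rw [FPlus, jostPlus, hk, h3, jostPlus]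

end

/-! ### Growth in n of the λ-derivatives of F⁺ -/

/-- The decaying free solution along a branch. -/
def freeMode (Z : ℂ → ℂ) (n : ℤ) (l : ℂ) : ℂ := (-1) ^ n * Complex.exp (Complex.I * n * Z l)

/-- The `r`-th `lam`-derivative of `F⁺_n` along a branch, up to the boundary. -/
def FPlusDeriv (a p q : ℤ → ℂ) (Z : ℂ → ℂ) (r : ℕ) (n : ℤ) (l : ℂ) : ℂ :=
  ∑ i ∈ Finset.range (r + 1), (r.choose i : ℂ) * iteratedDeriv i (freeMode Z n) l *
    jostDeriv a p q Z (r - i) n l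

lemma norm_freeMode (Z : ℂ → ℂ) (n : ℤ) (l : ℂ) :
    ‖freeMode Z n l‖ = Real.exp (-(n * (Z l).im)) := by
  rw [freeMode, norm_mul, norm_zpow, norm_neg, norm_one, one_zpow, one_mul, Complex.norm_exp]
  simp

/-- The derivatives of the free mode are the mode times a polynomial in `n`. -/
lemma exists_iteratedDeriv_freeMode {Z : ℂ → ℂ} {U : Set ℂ} (hU : IsOpen U)
    (hZ : AnalyticOnNhd ℂ Z U) (r : ℕ) :
    ∃ c : ℕ → ℂ → ℂ, (∀ j, AnalyticOnNhd ℂ (c j) U) ∧ (∀ j, r < j → c j = 0) ∧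
      (∀ l, c r l = (Complex.I * deriv Z l) ^ r) ∧
      ∀ l ∈ U, ∀ n : ℤ, iteratedDeriv r (freeMode Z n) l =
        freeMode Z n l * ∑ j ∈ Finset.range (r + 1), (n : ℂ) ^ j * c j l := by
  induction r with
  | zero =>
    refine ⟨fun j => if j = 0 then 1 else 0, fun j => ?_, fun j hj => ?_, fun l => ?_,
      fun l hl n => ?_⟩
    · dsimp only; split_ifs <;> exact fun l _ => analyticAt_const
    · simp [hj.ne']
    · simp
    · simp
  | succ r ih =>
    obtain ⟨c, ca, c0, cr, hc⟩ := ih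
    -- Differentiating the mode brings down i n Z', which shifts the coefficients by one degree; the
    -- other term differentiates the coefficients.
    refine ⟨fun j l => deriv (c j) l + Complex.I * deriv Z l * (if j = 0 then 0 else c (j - 1) l),
      fun j => ?_, fun j hj => ?_, fun l => ?_, fun l hl n => ?_⟩
    · have h1 := (ca j).deriv
      have h2 := hZ.deriv
      rcases j with _ | j
      · simpa using h1
      · exact h1.add ((analyticOnNhd_const.mul h2).mul (ca j))
    · funext l
      dsimp only
      rw [c0 j (by omega), if_neg (by omega), c0 (j - 1) (by omega)]
      simp
    · dsimp only
      rw [c0 (r + 1) (by omega), if_neg (by omega), Nat.add_sub_cancel, cr, pow_succ']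
      simp
    · have hev : iteratedDeriv r (freeMode Z n) =ᶠ[𝓝 l] fun l =>
          freeMode Z n l * ∑ j ∈ Finset.range (r + 1), (n : ℂ) ^ j * c j l := by
        filter_upwards [hU.mem_nhds hl] with m hm using hc m hm n
      rw [iteratedDeriv_succ, hev.deriv_eq]
      have d1 : HasDerivAt (freeMode Z n) (freeMode Z n l * (Complex.I * n * deriv Z l)) l := by
        have := (((hZ l hl).differentiableAt.hasDerivAt.const_mul (Complex.I * n)).cexp).const_mul
          ((-1 : ℂ) ^ n)
        refine this.congr_deriv ?_
        rw [freeMode]; ring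
      have d2 : HasDerivAt (fun l => ∑ j ∈ Finset.range (r + 1), (n : ℂ) ^ j * c j l)
          (∑ j ∈ Finset.range (r + 1), (n : ℂ) ^ j * deriv (c j) l) l :=
        HasDerivAt.fun_sum fun j _ => (ca j l hl).differentiableAt.hasDerivAt.const_mul _
      rw [(d1.fun_mul d2).deriv]
      simp only [mul_add, Finset.sum_add_distrib]
      rw [Finset.sum_range_succ _ (r + 1), c0 (r + 1) (by omega)]
      rw [Finset.sum_range_succ' (fun j => (n : ℂ) ^ j * (Complex.I * deriv Z l *
        (if j = 0 then 0 else c (j - 1) l)))]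
      have e : ∑ j ∈ Finset.range (r + 1), (n : ℂ) ^ (j + 1) * (Complex.I * deriv Z l *
          (if j + 1 = 0 then 0 else c (j + 1 - 1) l)) = Complex.I * n * deriv Z l *
          ∑ j ∈ Finset.range (r + 1), (n : ℂ) ^ j * c j l := by
        rw [Finset.mul_sum]
        refine Finset.sum_congr rfl fun j _ => ?_
        rw [if_neg (by omega), Nat.add_sub_cancel, pow_succ]
        ring
      rw [e]
      simp
      ring

section
variable {a p q : ℤ → ℂ} {z₀ : ℂ} {Z : ℂ → ℂ} {ρ L R : ℝ}

lemma analyticAt_freeMode (hB : IsLocalBranch z₀ Z ρ L R) (n : ℤ) {l : ℂ}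
    (hl : l ∈ Metric.ball (2 * Complex.cos (z₀ / 2)) ρ) : AnalyticAt ℂ (freeMode Z n) l := by
  have := hB.analytic l hl
  unfold freeMode
  fun_prop

lemma FPlus_branch (hsr : ShortRange a p q) (hB : IsLocalBranch z₀ Z ρ L R) (n : ℤ) {l : ℂ}
    (hl : l ∈ Metric.ball (2 * Complex.cos (z₀ / 2)) ρ) (him : 0 < (Z l).im) :
    FPlus a p q n l = freeMode Z n l * (1 + ∑' k, jostIncr a p q n k (Z l)) := by
  have h1 := FPlus_two_cos (a := a) (p := p) (q := q) him n
  rw [hB.right_inv l hl] at h1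
  rw [h1, (jostPlus_eq hsr him).2.2 n, ← free_mode_eq]
  rfl

lemma isOpen_side (hB : IsLocalBranch z₀ Z ρ L R) :
    IsOpen (Metric.ball (2 * Complex.cos (z₀ / 2)) (ρ / 2) ∩ Z ⁻¹' {z | 0 < z.im}) := by
  refine ContinuousOn.isOpen_inter_preimage (fun l hl => ?_) Metric.isOpen_ball
    (isOpen_lt continuous_const Complex.continuous_im)
  exact (hB.analytic l (Metric.ball_subset_ball (by linarith [hB.rho_pos])
    hl)).continuousAt.continuousWithinAt

lemma iteratedDeriv_FPlus (hsr : ShortRange a p q) (ha : ∀ n, ‖(a n)⁻¹‖ ≤ R)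
    (hB : IsLocalBranch z₀ Z ρ L R) (n : ℤ) {l : ℂ}
    (hl : l ∈ Metric.ball (2 * Complex.cos (z₀ / 2)) (ρ / 2)) (him : 0 < (Z l).im) :
    AnalyticAt ℂ (FPlus a p q n) l ∧
      ∀ r, iteratedDeriv r (FPlus a p q n) l = FPlusDeriv a p q Z r n l := by
  have hsub : Metric.ball (2 * Complex.cos (z₀ / 2)) (ρ / 2) ⊆
      Metric.ball (2 * Complex.cos (z₀ / 2)) ρ := Metric.ball_subset_ball (by linarith [hB.rho_pos])
  obtain ⟨h1, h2⟩ := analyticAt_normJost_branch hsr ha hB n hl him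
  have h3 := analyticAt_freeMode hB n (hsub hl)
  have hev : FPlus a p q n =ᶠ[𝓝 l]
      fun l => freeMode Z n l * (1 + ∑' k, jostIncr a p q n k (Z l)) := by
    filter_upwards [(isOpen_side hB).mem_nhds ⟨hl, him⟩] with m hm using
      FPlus_branch hsr hB n (hsub hm.1) hm.2
  refine ⟨(h3.mul h1).congr hev.symm, fun r => ?_⟩
  rw [hev.iteratedDeriv_eq, iteratedDeriv_fun_mul h3.contDiffAt h1.contDiffAt, FPlusDeriv]
  exact Finset.sum_congr rfl fun i _ => by rw [h2]

lemma continuousOn_FPlusDeriv (hsr : ShortRange a p q) (ha : ∀ n, ‖(a n)⁻¹‖ ≤ R)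
    (hB : IsLocalBranch z₀ Z ρ L R) (r : ℕ) (n : ℤ) :
    ContinuousOn (FPlusDeriv a p q Z r n) (closedSide z₀ Z ρ) := by
  refine continuousOn_finsetSum _ fun i _ => (continuousOn_const.mul ?_).mul
    (continuousOn_jostDeriv hsr ha hB _ n)
  intro l hl
  have := analyticAt_freeMode hB n (Metric.ball_subset_ball (by linarith [hB.rho_pos]) hl.1)
  rw [iteratedDeriv_eq_iterate]
  exact (this.iterated_deriv i).continuousAt.continuousWithinAt

lemma center_mem_closedSide (hB : IsLocalBranch z₀ Z ρ L R) (h : 0 ≤ z₀.im) :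
    2 * Complex.cos (z₀ / 2) ∈ closedSide z₀ Z ρ :=
  ⟨Metric.mem_ball_self (by linarith [hB.rho_pos]),
    by rw [Set.mem_ofPred_eq, hB.map_center]; exact h⟩

/-- For real z₀ the mode has modulus 1. In the Leibniz sum its i-th derivative grows at most like
|n|^i and the other factor like |n|^{r-i}. -/
lemma FPlusDeriv_growth (hsr : ShortRange a p q) (ha : ∀ n, ‖(a n)⁻¹‖ ≤ R)
    (hB : IsLocalBranch z₀ Z ρ L R) (h0 : z₀.im = 0) (r : ℕ) :
    ∃ C, 0 ≤ C ∧ ∀ n, ‖FPlusDeriv a p q Z r n (2 * Complex.cos (z₀ / 2))‖ ≤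
      C * (1 + |(n : ℝ)|) ^ r := by
  set l₀ := 2 * Complex.cos (z₀ / 2) with hl₀
  have hl : l₀ ∈ closedSide z₀ Z ρ := center_mem_closedSide hB h0.ge
  have hmode : ∀ i, ∃ C, 0 ≤ C ∧ ∀ n : ℤ, ‖iteratedDeriv i (freeMode Z n) l₀‖ ≤
      C * (1 + |(n : ℝ)|) ^ i := by
    intro i
    obtain ⟨c, -, -, -, hc⟩ := exists_iteratedDeriv_freeMode Metric.isOpen_ball
      (fun l hl => hB.analytic l hl) i
    refine ⟨∑ j ∈ Finset.range (i + 1), ‖c j l₀‖, Finset.sum_nonneg fun _ _ => norm_nonneg _,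
      fun n => ?_⟩
    rw [hc l₀ (Metric.mem_ball_self hB.rho_pos) n, norm_mul, norm_freeMode, hB.map_center, h0,
      mul_zero, neg_zero, Real.exp_zero, one_mul, Finset.sum_mul]
    refine norm_sum_le_of_le _ fun j hj => ?_
    rw [norm_mul, norm_pow, Complex.norm_intCast, mul_comm]
    gcongr
    have h1 : 1 ≤ 1 + |(n : ℝ)| := by linarith [abs_nonneg (n : ℝ)]
    calc |(n : ℝ)| ^ j ≤ (1 + |(n : ℝ)|) ^ j := by gcongr; linarith
      _ ≤ _ := pow_le_pow_right₀ h1 (by simpa [Nat.lt_succ_iff] using hj)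
  choose C hC hCb using hmode
  choose D hD hDb using fun i => exists_norm_jostDeriv_le hsr ha hB i
  refine ⟨∑ i ∈ Finset.range (r + 1), (r.choose i : ℝ) * (C i * D (r - i)),
    Finset.sum_nonneg fun i _ => by have := hC i; have := hD (r - i); positivity, fun n => ?_⟩
  rw [FPlusDeriv, Finset.sum_mul]
  refine norm_sum_le_of_le _ fun i hi => ?_
  have hir : i ≤ r := by simpa [Nat.lt_succ_iff] using hi
  rw [norm_mul, norm_mul, Complex.norm_natCast]
  have h1 := hCb i n
  have h2 := hDb (r - i) n l₀ hl
  have := hC i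
  calc _ ≤ (r.choose i : ℝ) * (C i * (1 + |(n : ℝ)|) ^ i) *
        (D (r - i) * (1 + |(n : ℝ)|) ^ (r - i)) := by gcongr
    _ = (r.choose i : ℝ) * (C i * D (r - i)) * ((1 + |(n : ℝ)|) ^ i *
        (1 + |(n : ℝ)|) ^ (r - i)) := by ring
    _ = _ := by rw [← pow_add, Nat.add_sub_cancel' hir]

lemma tendsto_intCast_pow_div {j r : ℕ} (h : j ≤ r) :
    Tendsto (fun n : ℤ => (n : ℂ) ^ j / (n : ℂ) ^ r) atTop (𝓝 (if j = r then 1 else 0)) := by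
  have hne : ∀ᶠ n : ℤ in atTop, (n : ℂ) ≠ 0 := by
    filter_upwards [eventually_gt_atTop 0] with n hn
    exact_mod_cast hn.ne'
  split_ifs with hjr
  · subst hjr
    refine tendsto_const_nhds.congr' ?_
    filter_upwards [hne] with n hn
    rw [div_self (pow_ne_zero _ hn)]
  · have h1 : Tendsto (fun n : ℤ => ((n : ℂ)⁻¹) ^ (r - j)) atTop (𝓝 (0 ^ (r - j))) := by
      refine Tendsto.pow ?_ _
      rw [tendsto_zero_iff_norm_tendsto_zero]
      have h2 : Tendsto (fun n : ℤ => (n : ℝ)) atTop atTop := tendsto_intCast_atTop_atTop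
      refine (h2.inv_tendsto_atTop.congr' ?_)
      filter_upwards [eventually_ge_atTop 0] with n hn
      rw [norm_inv, Complex.norm_intCast, abs_of_nonneg (by exact_mod_cast hn)]
      rfl
    rw [zero_pow (by omega)] at h1
    refine h1.congr' ?_
    filter_upwards [hne] with n hn
    have : r = j + (r - j) := by omega
    conv_rhs => rw [this, pow_add]
    rw [inv_pow]
    field_simp

/-- Towards +∞ the derivatives of the normalized solution stay bounded, so only the Leibniz term
with all r derivatives on the mode reaches order n^r. There the normalized solution itself tends to
1. -/
lemma tendsto_FPlusDeriv_div (hsr : ShortRange a p q) (ha : ∀ n, ‖(a n)⁻¹‖ ≤ R)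
    (hB : IsLocalBranch z₀ Z ρ L R) (h0 : z₀.im = 0) (r : ℕ) :
    Tendsto (fun n : ℤ => ‖FPlusDeriv a p q Z r n (2 * Complex.cos (z₀ / 2))‖ / (n : ℝ) ^ r) atTop
      (𝓝 (‖deriv Z (2 * Complex.cos (z₀ / 2))‖ ^ r)) := by
  set l₀ := 2 * Complex.cos (z₀ / 2) with hl₀
  have hl : l₀ ∈ closedSide z₀ Z ρ := center_mem_closedSide hB h0.ge
  have hmode : ∀ i, i ≤ r → ∃ Q : ℤ → ℂ,
      (∀ n, iteratedDeriv i (freeMode Z n) l₀ = freeMode Z n l₀ * Q n) ∧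
      Tendsto (fun n => Q n / (n : ℂ) ^ r) atTop
        (𝓝 (if i = r then (Complex.I * deriv Z l₀) ^ r else 0)) := by
    intro i hi
    obtain ⟨c, -, -, cr, hc⟩ := exists_iteratedDeriv_freeMode Metric.isOpen_ball
      (fun l hl => hB.analytic l hl) i
    refine ⟨fun n => ∑ j ∈ Finset.range (i + 1), (n : ℂ) ^ j * c j l₀,
      fun n => hc l₀ (Metric.mem_ball_self hB.rho_pos) n, ?_⟩
    have h1 : Tendsto (fun n : ℤ => ∑ j ∈ Finset.range (i + 1),
        (n : ℂ) ^ j / (n : ℂ) ^ r * c j l₀) atTop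
        (𝓝 (∑ j ∈ Finset.range (i + 1), (if j = r then 1 else 0) * c j l₀)) := by
      refine tendsto_finsetSum _ fun j hj => Tendsto.mul_const _ (tendsto_intCast_pow_div ?_)
      have : j ≤ i := by simpa [Nat.lt_succ_iff] using hj
      omega
    have h2 : (∑ j ∈ Finset.range (i + 1), (if j = r then 1 else 0) * c j l₀) =
        if i = r then (Complex.I * deriv Z l₀) ^ r else 0 := by
      simp only [ite_mul, one_mul, zero_mul, Finset.sum_ite_eq', Finset.mem_range]
      by_cases hir : i = r
      · subst hir
        simp [cr]
      · rw [if_neg (by omega), if_neg hir]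
    rw [h2] at h1
    refine h1.congr fun n => ?_
    rw [Finset.sum_div]
    exact Finset.sum_congr rfl fun j _ => by ring
  choose! Q hQ hQl using hmode
  have key : Tendsto (fun n : ℤ => ∑ i ∈ Finset.range (r + 1), (r.choose i : ℂ) *
      (Q i n / (n : ℂ) ^ r * jostDeriv a p q Z (r - i) n l₀)) atTop
      (𝓝 (∑ i ∈ Finset.range (r + 1), (r.choose i : ℂ) *
        (if i = r then (Complex.I * deriv Z l₀) ^ r else 0))) := by
    refine tendsto_finsetSum _ fun i hi => Tendsto.const_mul _ ?_
    have hir : i ≤ r := by simpa [Nat.lt_succ_iff] using hi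
    have h1 := hQl i hir
    by_cases hr : i = r
    · subst hr
      rw [if_pos rfl] at h1 ⊢
      have := h1.mul (tendsto_jostDeriv_zero hsr ha hB hl)
      simpa using this
    · rw [if_neg hr] at h1 ⊢
      obtain ⟨D, hD, hDb⟩ := exists_norm_jostDeriv_le_of_nonneg hsr ha hB (r - i)
      have h2 := h1.norm.mul_const D
      rw [norm_zero, zero_mul] at h2
      refine squeeze_zero_norm' ?_ h2
      filter_upwards [eventually_ge_atTop 0] with n hn
      rw [norm_mul]
      have := hDb n hn l₀ hl
      gcongr
  have h2 : (∑ i ∈ Finset.range (r + 1), (r.choose i : ℂ) *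
        (if i = r then (Complex.I * deriv Z l₀) ^ r else 0)) = (Complex.I * deriv Z l₀) ^ r := by
    simp [Finset.sum_ite_eq']
  rw [h2] at key
  have h3 := key.norm
  rw [norm_pow, norm_mul, Complex.norm_I, one_mul] at h3
  refine h3.congr' ?_
  filter_upwards [eventually_ge_atTop 0] with n hn
  have e : FPlusDeriv a p q Z r n l₀ / (n : ℂ) ^ r = freeMode Z n l₀ *
      ∑ i ∈ Finset.range (r + 1), (r.choose i : ℂ) *
      (Q i n / (n : ℂ) ^ r * jostDeriv a p q Z (r - i) n l₀) := by
    rw [FPlusDeriv, Finset.sum_div, Finset.mul_sum]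
    refine Finset.sum_congr rfl fun i hi => ?_
    rw [hQ i (by simpa [Nat.lt_succ_iff] using hi)]
    ring
  have hm : ‖freeMode Z n l₀‖ = 1 := by
    rw [norm_freeMode, hB.map_center, h0]; simp
  have hn' : ‖(n : ℂ) ^ r‖ = (n : ℝ) ^ r := by
    rw [norm_pow, Complex.norm_intCast, abs_of_nonneg (by exact_mod_cast hn)]
  rw [← hn', ← norm_div, e, norm_mul, hm, one_mul]

end

/-! ### Boundary values at spectral singularities -/

section
variable {a p q : ℤ → ℂ} {z₀ : ℝ} {Z : ℂ → ℂ} {ρ L R : ℝ}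

instance neBot_upper (z₀ : ℝ) : (𝓝[{z : ℂ | 0 < z.im}] (z₀ : ℂ)).NeBot := by
  rw [← mem_closure_iff_nhdsWithin_neBot, Complex.closure_setOfPred_lt_im]
  simp

lemma HasBoundaryValue.boundaryValue_eq {G : ℂ → ℂ} {c : ℂ} (h : HasBoundaryValue G z₀ c) :
    boundaryValue G z₀ = c := h.limUnder_eq

lemma hasBoundaryValue_principalVector (hsr : ShortRange a p q) (ha : ∀ n, ‖(a n)⁻¹‖ ≤ R)
    (hB : IsLocalBranch z₀ Z ρ L R) (r : ℕ) (n : ℤ) :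
    HasBoundaryValue (fun lam => principalVector a p q r lam n) z₀
      (FPlusDeriv a p q Z r n (2 * Complex.cos (z₀ / 2)) / (r.factorial : ℂ)) := by
  set l₀ := 2 * Complex.cos ((z₀ : ℂ) / 2) with hl₀
  have hl : l₀ ∈ closedSide z₀ Z ρ := center_mem_closedSide hB (by simp)
  unfold HasBoundaryValue principalVector
  refine Tendsto.div_const ?_ _
  have hcont : Tendsto (fun z : ℂ => 2 * Complex.cos (z / 2)) (𝓝 (z₀ : ℂ)) (𝓝 l₀) := by
    have : Continuous fun z : ℂ => 2 * Complex.cos (z / 2) := by fun_prop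
    exact this.tendsto _
  have hball : ∀ᶠ z in 𝓝 (z₀ : ℂ), 2 * Complex.cos (z / 2) ∈ Metric.ball l₀ (ρ / 2) :=
    hcont.eventually (Metric.ball_mem_nhds _ (by linarith [hB.rho_pos]))
  have hside : ∀ᶠ z in 𝓝[{z : ℂ | 0 < z.im}] (z₀ : ℂ),
      2 * Complex.cos (z / 2) ∈ Metric.ball l₀ (ρ / 2) ∧ 0 < (Z (2 * Complex.cos (z / 2))).im := by
    filter_upwards [hball.filter_mono nhdsWithin_le_nhds,
      hB.left_inv.filter_mono nhdsWithin_le_nhds, self_mem_nhdsWithin] with z h1 h2 h3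
    exact ⟨h1, by rw [h2]; exact h3⟩
  have h1 : Tendsto (fun z : ℂ => 2 * Complex.cos (z / 2)) (𝓝[{z : ℂ | 0 < z.im}] (z₀ : ℂ))
      (𝓝[closedSide z₀ Z ρ] l₀) := by
    refine tendsto_nhdsWithin_iff.mpr ⟨hcont.mono_left nhdsWithin_le_nhds, ?_⟩
    filter_upwards [hside] with z hz
    exact ⟨hz.1, hz.2.le⟩
  refine ((continuousOn_FPlusDeriv hsr ha hB r n l₀ hl).tendsto.comp h1).congr' ?_
  filter_upwards [hside] with z hz
  exact ((iteratedDeriv_FPlus hsr ha hB n hz.1 hz.2).2 r).symm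

lemma sin_ne_zero_of_mem_P0 (hz : z₀ ∈ P0) : Complex.sin z₀ ≠ 0 := by
  intro h
  obtain ⟨k, hk⟩ := Complex.sin_eq_zero_iff.mp h
  have hk' : z₀ = k * Real.pi := by exact_mod_cast hk
  obtain ⟨⟨h1, h2⟩, h3⟩ := hz
  have hpi := Real.pi_pos
  have k1 : (-1 : ℤ) < k := by
    by_contra! hle
    have : (k : ℝ) ≤ -1 := by exact_mod_cast hle
    nlinarith
  have k2 : k < 3 := by
    by_contra! hle
    have : (3 : ℝ) ≤ k := by exact_mod_cast hle
    nlinarith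
  apply h3
  interval_cases k
  · left; simpa using hk'
  · right; left; simpa using hk'
  · right; right; simpa using hk'

/-- The principal vectors at the boundary: existence of the boundary values, and their exact
order of growth. -/
lemma principalVectorSing_spec (hsr : ShortRange a p q) (hz : z₀ ∈ P0) (r : ℕ) :
    (∀ n, HasBoundaryValue (fun lam => principalVector a p q r lam n) z₀
        (principalVectorSing a p q r z₀ n)) ∧
    (∃ C, 0 ≤ C ∧ ∀ n, ‖principalVectorSing a p q r z₀ n‖ ≤ C * (1 + |(n : ℝ)|) ^ r) ∧
    ∃ c, 0 < c ∧ Tendsto (fun n : ℤ => ‖principalVectorSing a p q r z₀ n‖ / (n : ℝ) ^ r) atTop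
      (𝓝 c) := by
  obtain ⟨R₀, hR₀⟩ := hsr.exists_inv_le
  obtain ⟨Z, ρ, L, R, hR, hB⟩ := exists_isLocalBranch (sin_ne_zero_of_mem_P0 hz) R₀
  have ha : ∀ n, ‖(a n)⁻¹‖ ≤ R := fun n => (hR₀ n).trans hR
  have hb := hasBoundaryValue_principalVector hsr ha hB r
  have he : ∀ n, principalVectorSing a p q r z₀ n =
      FPlusDeriv a p q Z r n (2 * Complex.cos (z₀ / 2)) / (r.factorial : ℂ) :=
    fun n => (hb n).boundaryValue_eq
  have hf : (0 : ℝ) < r.factorial := by exact_mod_cast r.factorial_pos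
  have hn : ∀ n, ‖principalVectorSing a p q r z₀ n‖ =
      ‖FPlusDeriv a p q Z r n (2 * Complex.cos (z₀ / 2))‖ / r.factorial := fun n => by
    rw [he, norm_div, Complex.norm_natCast]
  refine ⟨fun n => by rw [he]; exact hb n, ?_, ?_⟩
  · obtain ⟨C, hC, h⟩ := FPlusDeriv_growth hsr ha hB (by simp) r
    refine ⟨C / r.factorial, by positivity, fun n => ?_⟩
    rw [hn, div_mul_eq_mul_div]
    gcongr
    exact h n
  · have hd := hB.deriv_ne
    refine ⟨‖deriv Z (2 * Complex.cos (z₀ / 2))‖ ^ r / r.factorial, by positivity, ?_⟩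
    refine ((tendsto_FPlusDeriv_div hsr ha hB (by simp) r).div_const _).congr fun n => ?_
    rw [hn]; ring

lemma not_memℓp_of_tendsto {u : ℤ → ℂ} {r : ℕ} {c : ℝ} (hc : 0 < c)
    (h : Tendsto (fun n : ℤ => ‖u n‖ / (n : ℝ) ^ r) atTop (𝓝 c)) : ¬ Memℓp u 2 := by
  intro hu
  have h1 := hu.summable (by norm_num)
  have h2 := h1.tendsto_cofinite_zero.mono_left atTop_le_cofinite
  have h3 : Tendsto (fun n : ℤ => ‖u n‖) atTop (𝓝 0) := by
    have := h2.sqrt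
    simpa [Real.sqrt_sq (norm_nonneg _)] using this
  have h4 : Tendsto (fun n : ℤ => ‖u n‖ / (n : ℝ) ^ r) atTop (𝓝 0) := by
    refine squeeze_zero' ?_ ?_ h3
    · filter_upwards [eventually_ge_atTop 0] with n hn
      have : (0 : ℝ) ≤ n := by exact_mod_cast hn
      positivity
    · filter_upwards [eventually_ge_atTop 1] with n hn
      have : (1 : ℝ) ≤ n := by exact_mod_cast hn
      exact div_le_self (norm_nonneg _) (one_le_pow₀ this)
  exact hc.ne' (tendsto_nhds_unique h h4)

/-- The weighted squares are O((1 + |n|)^{2r-2M}), and 2r - 2M ≤ -2. -/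
lemma mem_weightedSpace_of_growth {u : ℤ → ℂ} {r M : ℕ} (hrM : r < M) {C : ℝ}
    (h : ∀ n, ‖u n‖ ≤ C * (1 + |(n : ℝ)|) ^ r) : u ∈ weightedSpace (-(M : ℤ)) := by
  have hs : Summable fun n : ℤ => C ^ 2 * (1 / (n : ℝ) ^ 2) :=
    (Real.summable_one_div_int_pow.mpr one_lt_two).mul_left _
  refine Summable.of_norm_bounded_eventually hs ?_
  have hcof : ∀ᶠ n : ℤ in cofinite, n ≠ 0 := by
    have := (Set.finite_singleton (0 : ℤ)).compl_mem_cofinite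
    filter_upwards [this] with n hn using hn
  filter_upwards [hcof] with n hn
  have hn' : 0 < |(n : ℝ)| := by
    rw [abs_pos]; exact_mod_cast hn
  have hb := h n
  rw [← sq_abs (n : ℝ)]
  set x := |(n : ℝ)|
  rw [Real.norm_of_nonneg (by positivity), show (2 * -(M : ℤ)) = -((2 * M : ℕ) : ℤ) by
    push_cast; ring, zpow_neg, zpow_natCast]
  calc ((1 + x) ^ (2 * M))⁻¹ * ‖u n‖ ^ 2
      ≤ ((1 + x) ^ (2 * M))⁻¹ * (C * (1 + x) ^ r) ^ 2 := by gcongr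
    _ = C ^ 2 * ((1 + x) ^ (2 * r) / (1 + x) ^ (2 * M)) := by
      rw [mul_pow, ← pow_mul, mul_comm r 2]; ring
    _ ≤ C ^ 2 * (1 / x ^ 2) := by
      gcongr ?_ * ?_
      rw [div_le_div_iff₀ (by positivity) (by positivity), one_mul]
      calc (1 + x) ^ (2 * r) * x ^ 2 ≤ (1 + x) ^ (2 * r) * (1 + x) ^ 2 := by
            gcongr; linarith
        _ = (1 + x) ^ (2 * r + 2) := by rw [← pow_add]
        _ ≤ _ := pow_le_pow_right₀ (by linarith) (by omega)

end

/-! ### Eigenvalues: reflection, decay and the Wronskian -/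

section
variable {a p q : ℤ → ℂ}

lemma isOpen_Theta : IsOpen Theta := by
  unfold Theta
  exact (isCompact_Icc.image Complex.continuous_ofReal).isClosed.isOpen_compl

lemma twoArccosHalf_of_mem_Theta {lam : ℂ} (h : lam ∈ Theta) :
    0 < (twoArccosHalf lam).im ∧ 2 * Complex.cos (twoArccosHalf lam / 2) = lam := by
  obtain ⟨z, hz, rfl⟩ := exists_branch_point h
  obtain ⟨h1, k, hk⟩ := twoArccosHalf_spec hz
  refine ⟨h1, ?_⟩
  rw [hk, show (z + 4 * k * Real.pi) / 2 = z / 2 + k * (2 * Real.pi) by ring,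
      Complex.cos_add_int_mul_two_pi]

lemma FPlus_isJostPlus (hsr : ShortRange a p q) {lam : ℂ} (h : lam ∈ Theta) :
    IsJostPlus a p q (twoArccosHalf lam) (fun n => FPlus a p q n lam) :=
  (jostPlus_eq hsr (twoArccosHalf_of_mem_Theta h).1).1

lemma pencil_FPlus (hsr : ShortRange a p q) {lam : ℂ} (h : lam ∈ Theta) (n : ℤ) :
    pencil a p q lam (fun n => FPlus a p q n lam) n = 0 := by
  have := (FPlus_isJostPlus hsr h).1 n
  rwa [(twoArccosHalf_of_mem_Theta h).2] at this

/-- The coefficients `a` of the pencil reflected about the origin. -/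
def reflectA (a : ℤ → ℂ) (n : ℤ) : ℂ := a (-n - 1)

/-- The coefficients `p`, `q` of the pencil reflected about the origin. -/
def reflect (u : ℤ → ℂ) (n : ℤ) : ℂ := u (-n)

lemma ShortRange.reflect (h : ShortRange a p q) :
    ShortRange (reflectA a) (reflect p) (reflect q) := by
  have hneg : ∀ u : ℤ → ℂ, (∀ r : ℕ, Summable fun n : ℤ => (1 + |(n : ℝ)|) ^ r * ‖u n‖) →
      ∀ r : ℕ, Summable fun n : ℤ => (1 + |(n : ℝ)|) ^ r * ‖u (-n)‖ := by
    intro u hu r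
    refine ((Equiv.neg ℤ).summable_iff.mpr (hu r)).congr fun n => ?_
    simp
  refine ⟨fun n => h.a_ne _, fun r => ?_, hneg p h.p_moment, hneg q h.q_moment⟩
  have h1 : Summable fun n : ℤ =>
      (1 + |((-n - 1 : ℤ) : ℝ)|) ^ r * ‖(a (-n - 1))⁻¹ - 1‖ :=
    ((Equiv.neg ℤ).trans (Equiv.subRight 1)).summable_iff.mpr (h.a_moment r)
  refine Summable.of_nonneg_of_le (fun n => by positivity) (fun n => ?_) (h1.mul_left (2 ^ r))
  have h2 : 1 + |(n : ℝ)| ≤ 2 * (1 + |((-n - 1 : ℤ) : ℝ)|) := by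
    push_cast
    have h3 := abs_add_le (-(n : ℝ) - 1) 1
    rw [sub_add_cancel, abs_neg, abs_one] at h3
    linarith [abs_nonneg (-(n : ℝ) - 1)]
  rw [← mul_assoc, ← mul_pow]
  unfold reflectA
  gcongr

/-- The coefficient a_n belongs to the edge between n and n + 1. Under n ↦ -n this becomes the edge
between -n - 1 and -n, hence the extra shift in `reflectA`. -/
lemma isJostMinus_iff {z : ℂ} {f : ℤ → ℂ} :
    IsJostMinus a p q z f ↔
      IsJostPlus (reflectA a) (reflect p) (reflect q) z (fun n => f (-n)) := by
  have h1 : ∀ n, pencil (reflectA a) (reflect p) (reflect q) (2 * Complex.cos (z / 2))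
      (fun n => f (-n)) n = pencil a p q (2 * Complex.cos (z / 2)) f (-n) := by
    intro n
    rw [pencil_eq, pencil_eq]
    simp only [reflectA, reflect]
    rw [show -(n + 1) = -n - 1 by ring, show -(n - 1) - 1 = -n by ring,
      show -(n - 1) = -n + 1 by ring]
    ring
  unfold IsJostMinus IsJostPlus
  refine and_congr ⟨fun h n => by rw [h1]; exact h _, fun h n => ?_⟩ ?_
  · have := h (-n)
    rwa [h1, neg_neg] at this
  · rw [← map_neg_atTop (G := ℤ), tendsto_map'_iff]
    refine tendsto_congr fun n => ?_
    simp only [Function.comp]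
    rw [zpow_neg, ← inv_zpow, inv_neg_one]
    push_cast
    ring_nf

lemma FMinus_eq (hsr : ShortRange a p q) {lam : ℂ} (h : lam ∈ Theta) (n : ℤ) :
    FMinus a p q n lam = FPlus (reflectA a) (reflect p) (reflect q) (-n) lam := by
  obtain ⟨h1, h2, -⟩ := jostPlus_eq hsr.reflect (twoArccosHalf_of_mem_Theta h).1
  set z := twoArccosHalf lam
  have hex : ∃ f, IsJostMinus a p q z f := by
    refine ⟨fun n => jostPlus (reflectA a) (reflect p) (reflect q) z (-n), ?_⟩
    rw [isJostMinus_iff]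
    simpa using h1
  have h3 : IsJostMinus a p q z (jostMinus a p q z) := Classical.epsilon_spec hex
  have h4 := congrFun (h2 _ (isJostMinus_iff.mp h3)) (-n)
  simp only [neg_neg] at h4
  exact h4

lemma FMinus_isJostMinus (hsr : ShortRange a p q) {lam : ℂ} (h : lam ∈ Theta) :
    IsJostMinus a p q (twoArccosHalf lam) (fun n => FMinus a p q n lam) := by
  rw [isJostMinus_iff]
  simpa only [FMinus_eq hsr h, neg_neg] using FPlus_isJostPlus hsr.reflect h

lemma pencil_FMinus (hsr : ShortRange a p q) {lam : ℂ} (h : lam ∈ Theta) (n : ℤ) :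
    pencil a p q lam (fun n => FMinus a p q n lam) n = 0 := by
  have := (FMinus_isJostMinus hsr h).1 n
  rwa [(twoArccosHalf_of_mem_Theta h).2] at this

/-- `F⁺` is analytic on `Θ`, and its derivatives decay exponentially at `+∞`. -/
lemma FPlus_analyticAt_and_decay (hsr : ShortRange a p q) {lam : ℂ} (h : lam ∈ Theta) :
    (∀ n, AnalyticAt ℂ (FPlus a p q n) lam) ∧
    ∃ η, 0 < η ∧ ∀ r, ∃ C, 0 ≤ C ∧ ∀ n : ℤ, 0 ≤ n →
      ‖iteratedDeriv r (FPlus a p q n) lam‖ ≤ C * Real.exp (-(η * n)) := by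
  obtain ⟨z₀, hz, rfl⟩ := exists_branch_point h
  obtain ⟨R₀, hR₀⟩ := hsr.exists_inv_le
  obtain ⟨Z, ρ, L, R, hR, hB⟩ := exists_isLocalBranch (sin_ne_zero_of_im_ne_zero hz.ne') R₀
  have ha : ∀ n, ‖(a n)⁻¹‖ ≤ R := fun n => (hR₀ n).trans hR
  set l₀ := 2 * Complex.cos (z₀ / 2) with hl₀
  have hl : l₀ ∈ Metric.ball l₀ (ρ / 2) := Metric.mem_ball_self (by linarith [hB.rho_pos])
  refine ⟨fun n => (iteratedDeriv_FPlus hsr ha hB n hl (by rw [hB.map_center]; exact hz)).1, ?_⟩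
  -- On a disc where Im Z stays above Im z₀ / 2 the mode decays at a uniform rate. Cauchy's estimate
  -- on this disc, the same for all n, passes that rate to every derivative.
  have hU : ∀ᶠ l in 𝓝 l₀, l ∈ Metric.ball l₀ (ρ / 2) ∧ z₀.im / 2 < (Z l).im := by
    refine Filter.Eventually.and (Metric.isOpen_ball.mem_nhds hl) ?_
    have hc : ContinuousAt (fun l => (Z l).im) l₀ :=
      Complex.continuous_im.continuousAt.comp
        (hB.analytic _ (Metric.mem_ball_self hB.rho_pos)).continuousAt
    refine hc.eventually_const_lt ?_
    dsimp only
    rw [hB.map_center]; linarith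
  obtain ⟨s, hs, hball⟩ := Metric.nhds_basis_closedBall.mem_iff.mp hU
  obtain ⟨C, hC, hCb⟩ := exists_norm_jostDeriv_le_of_nonneg hsr ha hB 0
  have hb : ∀ n : ℤ, 0 ≤ n → ∀ l ∈ Metric.closedBall l₀ s,
      ‖FPlus a p q n l‖ ≤ C * Real.exp (-(z₀.im / 2 * n)) := by
    intro n hn l hls
    obtain ⟨h1, h2⟩ := hball hls
    have him : 0 < (Z l).im := by linarith
    have h3 := (iteratedDeriv_FPlus hsr ha hB n h1 him).2 0
    have h4 : FPlus a p q n l = freeMode Z n l * jostDeriv a p q Z 0 n l := by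
      simpa [FPlusDeriv] using h3
    rw [h4, norm_mul, norm_freeMode, mul_comm]
    have h5 := hCb n hn l ⟨h1, him.le⟩
    have hn' : (0 : ℝ) ≤ n := by exact_mod_cast hn
    have h6 := mul_le_mul_of_nonneg_right h2.le hn'
    refine mul_le_mul h5 (Real.exp_le_exp.mpr (by linarith)) (Real.exp_nonneg _) hC
  refine ⟨z₀.im / 2, by linarith, fun r => ⟨r.factorial * C / s ^ r, by positivity,
    fun n hn => ?_⟩⟩
  refine (Complex.norm_iteratedDeriv_le_of_forall_mem_sphere_norm_le r hs ?_
    fun l hls => hb n hn l (Metric.sphere_subset_closedBall hls)).trans (le_of_eq (by ring))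
  refine DifferentiableOn.diffContOnCl ?_
  rw [closure_ball _ hs.ne']
  intro l hls
  obtain ⟨h1, h2⟩ := hball hls
  exact (iteratedDeriv_FPlus hsr ha hB n h1
    (by linarith)).1.differentiableAt.differentiableWithinAt

lemma FMinus_eventuallyEq (hsr : ShortRange a p q) {lam : ℂ} (h : lam ∈ Theta) (n : ℤ) :
    FMinus a p q n =ᶠ[𝓝 lam] FPlus (reflectA a) (reflect p) (reflect q) (-n) := by
  filter_upwards [isOpen_Theta.mem_nhds h] with l hl using FMinus_eq hsr hl n

lemma FMinus_analyticAt_and_decay (hsr : ShortRange a p q) {lam : ℂ} (h : lam ∈ Theta) :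
    (∀ n, AnalyticAt ℂ (FMinus a p q n) lam) ∧
    ∃ η, 0 < η ∧ ∀ r, ∃ C, 0 ≤ C ∧ ∀ n : ℤ, n ≤ 0 →
      ‖iteratedDeriv r (FMinus a p q n) lam‖ ≤ C * Real.exp (η * n) := by
  obtain ⟨h1, η, hη, h2⟩ := FPlus_analyticAt_and_decay hsr.reflect h
  refine ⟨fun n => (h1 (-n)).congr (FMinus_eventuallyEq hsr h n).symm, η, hη, fun r => ?_⟩
  obtain ⟨C, hC, hb⟩ := h2 r
  refine ⟨C, hC, fun n hn => ?_⟩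
  rw [(FMinus_eventuallyEq hsr h n).iteratedDeriv_eq]
  refine (hb (-n) (by omega)).trans (le_of_eq ?_)
  push_cast
  ring_nf

/-- Two-sided induction for second order recurrences. -/
lemma int_induction_two {V : ℤ → Prop} (h0 : V 0) (h1 : V 1)
    (hup : ∀ n, V (n - 1) → V n → V (n + 1)) (hdown : ∀ n, V (n + 1) → V n → V (n - 1)) :
    ∀ n, V n := by
  have key : ∀ n : ℤ, V n ∧ V (n + 1) := by
    intro n
    induction n with
    | zero => exact ⟨h0, by simpa using h1⟩
    | succ n ih => exact ⟨ih.2, hup _ (by simpa using ih.1) ih.2⟩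
    | pred n ih => exact ⟨hdown _ ih.2 ih.1, by simpa using ih.1⟩
  exact fun n => (key n).1

lemma pencil_up (hane : ∀ n, a n ≠ 0) {lam : ℂ} {y : ℤ → ℂ} {n : ℤ}
    (h : pencil a p q lam y n = 0) : y (n + 1) =
      (a n)⁻¹ * ((a n + a (n - 1) - (q n + 2 * lam * p n + lam ^ 2)) * y n -
        a (n - 1) * y (n - 1)) := by
  rw [pencil_eq] at h
  have := hane n
  rw [eq_inv_mul_iff_mul_eq₀ this]
  linear_combination h

lemma pencil_down (hane : ∀ n, a n ≠ 0) {lam : ℂ} {y : ℤ → ℂ} {n : ℤ}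
    (h : pencil a p q lam y n = 0) : y (n - 1) =
      (a (n - 1))⁻¹ * ((a n + a (n - 1) - (q n + 2 * lam * p n + lam ^ 2)) * y n -
        a n * y (n + 1)) := by
  rw [pencil_eq] at h
  have := hane (n - 1)
  rw [eq_inv_mul_iff_mul_eq₀ this]
  linear_combination h

/-- A solution family whose values at `0` and `1` vanish to order `m` at `lam₀` vanishes there to
order `m` at every site. -/
lemma vanishing_of_zero_one (hane : ∀ n, a n ≠ 0) {lam₀ : ℂ} {m : ℕ} {y : ℤ → ℂ → ℂ}
    (hy : ∀ᶠ l in 𝓝 lam₀, ∀ n, pencil a p q l (fun n => y n l) n = 0)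
    (h0 : ∃ g, AnalyticAt ℂ g lam₀ ∧ ∀ᶠ l in 𝓝 lam₀, y 0 l = (l - lam₀) ^ m * g l)
    (h1 : ∃ g, AnalyticAt ℂ g lam₀ ∧ ∀ᶠ l in 𝓝 lam₀, y 1 l = (l - lam₀) ^ m * g l) (n : ℤ) :
    ∃ g, AnalyticAt ℂ g lam₀ ∧ ∀ᶠ l in 𝓝 lam₀, y n l = (l - lam₀) ^ m * g l := by
  refine int_induction_two (V := fun n => ∃ g, AnalyticAt ℂ g lam₀ ∧
    ∀ᶠ l in 𝓝 lam₀, y n l = (l - lam₀) ^ m * g l) h0 h1 ?_ ?_ n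
  · rintro n ⟨g₁, ga₁, h₁⟩ ⟨g₂, ga₂, h₂⟩
    refine ⟨fun l => (a n)⁻¹ * ((a n + a (n - 1) - (q n + 2 * l * p n + l ^ 2)) * g₂ l -
        a (n - 1) * g₁ l), by fun_prop, ?_⟩
    filter_upwards [hy, h₁, h₂] with l hl e1 e2
    rw [pencil_up hane (hl n), e1, e2]
    ring
  · rintro n ⟨g₁, ga₁, h₁⟩ ⟨g₂, ga₂, h₂⟩
    refine ⟨fun l => (a (n - 1))⁻¹ * ((a n + a (n - 1) - (q n + 2 * l * p n + l ^ 2)) * g₂ l -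
        a n * g₁ l), by fun_prop, ?_⟩
    filter_upwards [hy, h₁, h₂] with l hl e1 e2
    rw [pencil_down hane (hl n), e1, e2]
    ring

/-- Two consecutive zeros would make the solution vanish identically, against its normalization at
-∞. -/
lemma FMinus_zero_or_one_ne_zero (hsr : ShortRange a p q) {lam : ℂ} (h : lam ∈ Theta) :
    FMinus a p q 0 lam ≠ 0 ∨ FMinus a p q 1 lam ≠ 0 := by
  by_contra! hcon
  have hzero : ∀ n, FMinus a p q n lam = 0 := by
    refine int_induction_two hcon.1 hcon.2 (fun n h1 h2 => ?_) (fun n h1 h2 => ?_)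
    · rw [pencil_up hsr.a_ne (pencil_FMinus hsr h n), h1, h2]; ring
    · rw [pencil_down hsr.a_ne (pencil_FMinus hsr h n), h1, h2]; ring
  have hl := (FMinus_isJostMinus hsr h).2
  simp only [hzero, zero_div] at hl
  exact zero_ne_one (tendsto_nhds_unique tendsto_const_nhds hl)

/-- At an eigenvalue of multiplicity `m`, the jet of `F⁺` of order `m - 1` is the product of a
scalar jet and the jet of `F⁻`. -/
lemma exists_iteratedDeriv_FPlus_eq (hsr : ShortRange a p q) {lam : ℂ} {m : ℕ}
    (h : IsEigenvalueOfMult a p q lam m) :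
    ∃ c : ℂ → ℂ, ∀ r < m, ∀ n, iteratedDeriv r (FPlus a p q n) lam =
      ∑ i ∈ Finset.range (r + 1), (r.choose i : ℂ) * iteratedDeriv i c lam *
        iteratedDeriv (r - i) (FMinus a p q n) lam := by
  obtain ⟨hlam, -, hord⟩ := h
  have hP := (FPlus_analyticAt_and_decay hsr hlam).1
  have hM := (FMinus_analyticAt_and_decay hsr hlam).1
  have hH : AnalyticAt ℂ (HFun a p q) lam := by
    have h1 := hP 0
    have h2 := hP 1
    have h3 := hM 0
    have h4 := hM 1
    unfold HFun wronskian
    fun_prop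
  obtain ⟨g, ga, hg⟩ := (natCast_le_analyticOrderAt hH).mp hord.ge
  simp only [smul_eq_mul] at hg
  obtain ⟨j, hj01, hj⟩ : ∃ j : ℤ, (j = 0 ∨ j = 1) ∧ FMinus a p q j lam ≠ 0 := by
    rcases FMinus_zero_or_one_ne_zero hsr hlam with h | h
    · exact ⟨0, Or.inl rfl, h⟩
    · exact ⟨1, Or.inr rfl, h⟩
  -- This combination solves the pencil equation and vanishes at j. At the other site of {0, 1} it
  -- equals ±H / a_0, so it vanishes to order m at λ_j, and the recurrence carries this to all
  -- sites.
  set K : ℤ → ℂ → ℂ := fun n l => FMinus a p q j l * FPlus a p q n l -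
    FPlus a p q j l * FMinus a p q n l with hK
  have hKp : ∀ᶠ l in 𝓝 lam, ∀ n, pencil a p q l (fun n => K n l) n = 0 := by
    filter_upwards [isOpen_Theta.mem_nhds hlam] with l hl n
    have e1 := pencil_FPlus hsr hl n
    have e2 := pencil_FMinus hsr hl n
    rw [pencil_eq] at e1 e2 ⊢
    simp only [hK]
    linear_combination FMinus a p q j l * e1 - FPlus a p q j l * e2
  have hvan : ∀ n, ∃ g, AnalyticAt ℂ g lam ∧ ∀ᶠ l in 𝓝 lam, K n l = (l - lam) ^ m * g l := by
    have ha0 := hsr.a_ne 0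
    have hz : ∃ g, AnalyticAt ℂ g lam ∧ ∀ᶠ l in 𝓝 lam, K j l = (l - lam) ^ m * g l :=
      ⟨0, analyticAt_const, Eventually.of_forall fun l => by simp [hK, mul_comm]⟩
    rcases hj01 with rfl | rfl
    · refine vanishing_of_zero_one hsr.a_ne hKp hz ⟨fun l => (a 0)⁻¹ * g l, by fun_prop, ?_⟩
      filter_upwards [hg] with l hl
      simp only [HFun, wronskian] at hl
      rw [mul_left_comm, ← hl, inv_mul_cancel_left₀ ha0]
      simp only [hK]; ring
    · refine vanishing_of_zero_one hsr.a_ne hKp ⟨fun l => -((a 0)⁻¹ * g l), by fun_prop, ?_⟩ hz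
      filter_upwards [hg] with l hl
      simp only [HFun, wronskian] at hl
      rw [mul_neg, mul_left_comm, ← hl, inv_mul_cancel_left₀ ha0]
      simp only [hK]; ring
  refine ⟨fun l => FPlus a p q j l / FMinus a p q j l, fun r hr n => ?_⟩
  have hc : AnalyticAt ℂ (fun l => FPlus a p q j l / FMinus a p q j l) lam := (hP j).div (hM j) hj
  obtain ⟨k, ka, hk⟩ := hvan n
  have hrem : AnalyticAt ℂ (fun l => (l - lam) ^ m * (k l / FMinus a p q j l)) lam := by
    have := ka.div (hM j) hj
    exact ((analyticAt_id.sub analyticAt_const).pow m).mul this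
  have hrem0 : iteratedDeriv r (fun l => (l - lam) ^ m * (k l / FMinus a p q j l)) lam = 0 := by
    refine (natCast_le_analyticOrderAt_iff_iteratedDeriv_eq_zero hrem).mp ?_ r hr
    exact (natCast_le_analyticOrderAt hrem).mpr ⟨_, ka.div (hM j) hj, Eventually.of_forall
      fun l => rfl⟩
  -- Dividing by the nonvanishing F⁻_j gives F⁺_n = c F⁻_n plus a remainder of order m, invisible to
  -- derivatives of order r < m.
  have hev : FPlus a p q n =ᶠ[𝓝 lam] fun l =>
      FPlus a p q j l / FMinus a p q j l * FMinus a p q n l +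
        (l - lam) ^ m * (k l / FMinus a p q j l) := by
    filter_upwards [hk, (hM j).continuousAt.eventually_ne hj] with l h1 h2
    rw [← mul_div_assoc, ← h1]
    simp only [hK]
    field_simp
    ring
  have hcm : AnalyticAt ℂ (fun l => FPlus a p q j l / FMinus a p q j l * FMinus a p q n l) lam :=
    hc.mul (hM n)
  rw [hev.iteratedDeriv_eq, iteratedDeriv_fun_add hcm.contDiffAt hrem.contDiffAt, hrem0, add_zero,
    iteratedDeriv_fun_mul hc.contDiffAt (hM n).contDiffAt]

lemma memℓp_of_exp_decay {u : ℤ → ℂ} {C η : ℝ} (hη : 0 < η)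
    (h : ∀ n : ℤ, ‖u n‖ ≤ C * Real.exp (-(η * |(n : ℝ)|))) : Memℓp u 2 := by
  have hs := (summable_moment_exp_neg_rpow (show 0 < 2 * η by positivity)
    (show (1 : ℝ) / 2 ≤ 1 by norm_num) 0).mul_left (C ^ 2)
  refine memℓp_gen (Summable.of_nonneg_of_le (fun n => by positivity) (fun n => ?_) hs)
  have h1 := h n
  simp only [ENNReal.toReal_ofNat, Real.rpow_ofNat, pow_zero, one_mul, Real.rpow_one]
  calc ‖u n‖ ^ 2 ≤ (C * Real.exp (-(η * |(n : ℝ)|))) ^ 2 := by gcongr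
    _ = _ := by
      rw [mul_pow, ← Real.exp_nat_mul]
      congr 2
      push_cast; ring

/-- For n ≥ 0 the decay is that of F⁺. For n ≤ 0 it comes from F⁻ through the jet identity, the only
place where r < m matters. -/
lemma memℓp_principalVector (hsr : ShortRange a p q) {lam : ℂ} {m : ℕ}
    (h : IsEigenvalueOfMult a p q lam m) {r : ℕ} (hr : r < m) :
    Memℓp (principalVector a p q r lam) 2 := by
  obtain ⟨c, hc⟩ := exists_iteratedDeriv_FPlus_eq hsr h
  obtain ⟨-, η₁, hη₁, hP⟩ := FPlus_analyticAt_and_decay hsr h.1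
  obtain ⟨-, η₂, hη₂, hM⟩ := FMinus_analyticAt_and_decay hsr h.1
  obtain ⟨C, hC, hCb⟩ := hP r
  choose D hD hDb using hM
  set E := ∑ i ∈ Finset.range (r + 1), (r.choose i : ℝ) * ‖iteratedDeriv i c lam‖ * D (r - i)
    with hE
  have hE0 : 0 ≤ E := Finset.sum_nonneg fun i _ => by have := hD (r - i); positivity
  have hf : (0 : ℝ) < r.factorial := by exact_mod_cast r.factorial_pos
  set η := min η₁ η₂ with hη
  refine memℓp_of_exp_decay (η := η) (C := (C + E) / r.factorial) (lt_min hη₁ hη₂) fun n => ?_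
  rw [principalVector, norm_div, Complex.norm_natCast, div_mul_eq_mul_div]
  gcongr
  rcases le_total 0 n with hn | hn
  · have hn' : (0 : ℝ) ≤ n := by exact_mod_cast hn
    rw [abs_of_nonneg hn']
    refine (hCb n hn).trans ?_
    have : η ≤ η₁ := min_le_left _ _
    gcongr
    linarith
  · have hn' : (n : ℝ) ≤ 0 := by exact_mod_cast hn
    rw [abs_of_nonpos hn', hc r hr n]
    have h1 : ‖∑ i ∈ Finset.range (r + 1), (r.choose i : ℂ) * iteratedDeriv i c lam *
        iteratedDeriv (r - i) (FMinus a p q n) lam‖ ≤ E * Real.exp (η₂ * n) := by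
      rw [hE, Finset.sum_mul]
      refine norm_sum_le_of_le _ fun i _ => ?_
      rw [norm_mul, norm_mul, Complex.norm_natCast, mul_assoc _ (D (r - i))]
      have := hDb (r - i) n hn
      gcongr
    refine h1.trans ?_
    have : η ≤ η₂ := min_le_right _ _
    gcongr
    · linarith
    · nlinarith

end

end

theorem theorem16 (a p q : ℤ → ℂ) (ha : ∀ n, a n ≠ 0)
    (ε δ : ℝ) (hε : 0 < ε) (hδ : 1 / 2 ≤ δ) (hδ' : δ ≤ 1)
    (hcond : BddAbove (Set.range fun n : ℤ =>
      Real.exp (ε * |(n : ℝ)| ^ δ) * (‖1 - a n‖ + ‖p n‖ + ‖q n‖))) :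
    -- (i) eigenvalues
    (∀ (lam : ℂ) (m : ℕ), IsEigenvalueOfMult a p q lam m → ∀ r < m,
      (∀ n, AnalyticAt ℂ (FPlus a p q n) lam) ∧
      Memℓp (principalVector a p q r lam) 2) ∧
    -- (ii) spectral singularities
    (∀ (z₀ : ℝ) (m : ℕ), IsSpectralSingularityOfMult a p q z₀ m → ∀ r < m,
      (∀ n, HasBoundaryValue (fun lam => principalVector a p q r lam n) z₀
        (principalVectorSing a p q r z₀ n)) ∧
      ¬ Memℓp (principalVectorSing a p q r z₀) 2) ∧
    -- (iii) spectral singularities, weighted spaces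
    (∀ (z₀ : ℝ) (m : ℕ), IsSpectralSingularityOfMult a p q z₀ m → ∀ r < m,
      principalVectorSing a p q r z₀ ∈ weightedSpace (-(m : ℤ)) ∧
      ∀ p₀ : ℕ, IsGreatest (multiplicities a p q) p₀ →
        principalVectorSing a p q r z₀ ∈ weightedSpace (-(p₀ : ℤ)) ∧
        principalVectorSing a p q r z₀ ∈ weightedSpace (-((p₀ : ℤ) + 1))) := by
  have hsr := shortRange_of_bddAbove ha hε hδ hcond
  refine ⟨fun lam m h r hr => ⟨(FPlus_analyticAt_and_decay hsr h.1).1,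
    memℓp_principalVector hsr h hr⟩, fun z₀ m h r _ => ?_, fun z₀ m h r hr => ?_⟩
  · obtain ⟨h1, -, c, hc, h2⟩ := principalVectorSing_spec hsr h.1 r
    exact ⟨h1, not_memℓp_of_tendsto hc h2⟩
  · obtain ⟨-, ⟨C, -, hb⟩, -⟩ := principalVectorSing_spec hsr h.1 r
    refine ⟨mem_weightedSpace_of_growth hr hb, fun p₀ hp => ?_⟩
    have hm : m ≤ p₀ := hp.2 (Or.inr ⟨z₀, h⟩)
    refine ⟨mem_weightedSpace_of_growth (hr.trans_le hm) hb, ?_⟩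
    exact_mod_cast mem_weightedSpace_of_growth (M := p₀ + 1) (by omega) hb
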